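/- Let $n\ge 1$, let $\mathbf X=[\mathbf x_1,\dots,\mathbf x_n]\in\mathbb R^{p\times n}$ with labels $y_1,\dots,y_n\in\{1,\dots,J\}$, let $c_{ij}=1$ if $y_i\ne j$ and $c_{ij}=0$ otherwise, let $\lambda_1,\lambda_2,\lambda_3\ge 0$, and let $\alpha,\mu,\nu>0$. Write $\mathbf e$, $\mathbf E$ for the all-ones vector and matrix, $[t]_+=\max(0,t)$, $\|\mathbf U\|_1=\sum_{i,j}|u_{ij}|$, $\mathbf v^j$ for the $j$th row of $\mathbf V$, $\langle\cdot,\cdot\rangle$ for the Frobenius inner product, $\mathcal D=\{(\mathbf W,\mathbf b)\in\mathbb R^{p\times J}\times\mathbb R^J:\ \mathbf W\mathbf e=\mathbf 0,\ \mathbf e^\top\mathbf b=0\}$ and $\mathbf R(\mathbf W,\mathbf b,\mathbf A)=\mathbf X^\top\mathbf W+\mathbf e\mathbf b^\top+\mathbf E-\mathbf A$, where $\mathbf A\in\mathbb R^{n\times J}$. For $\mathbf U,\mathbf V\in\mathbb R^{p\times J}$ and $q\in\{2,\infty\}$ (group lasso: $q=2$; supnorm: $q=\infty$) put $$F_1(\mathbf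 W,\mathbf b,\mathbf A,\mathbf U)=\tfrac1n\sum_{i,j}c_{ij}[a_{ij}]_++\lambda_1\|\mathbf U\|_1+\tfrac{\lambda_2}2\|\mathbf W\|_F^2+\tfrac{\lambda_3}2\|\mathbf b\|_2^2,$$ $$F_2(\mathbf W,\mathbf b,\mathbf A,\mathbf U,\mathbf V)=\tfrac1n\sum_{i,j}c_{ij}[a_{ij}]_++\lambda_1\|\mathbf U\|_1+\lambda_2\sum_{j=1}^p\|\mathbf v^j\|_q+\tfrac{\lambda_3}2\|\mathbf b\|_2^2.$$ Let $F_1^*$ be the minimum of $F_1$ subject to $\mathbf R(\mathbf W,\mathbf b,\mathbf A)=\mathbf 0$, $\mathbf U=\mathbf W$, $(\mathbf W,\mathbf b)\in\mathcal D$, and $F_2^*$ the minimum of $F_2$ subject to the same constraints and $\mathbf V=\mathbf W$. Put $$\mathcal L_1=F_1+\langle\boldsymbol\Lambda,\mathbf W-\mathbf U\rangle+\tfrac\mu2\|\mathbf W-\mathbf U\|_F^2+\langle\boldsymbol\Pi,\mathbf R(\mathbf W,\mathbf b,\mathbf A)\rangle+\tfrac\alpha2\|\mathbf R(\mathbf W,\mathbf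 b,\mathbf A)\|_F^2,$$ $$\mathcal L_2=F_2+\langle\boldsymbol\Pi,\mathbf R(\mathbf W,\mathbf b,\mathbf A)\rangle+\tfrac\alpha2\|\mathbf R(\mathbf W,\mathbf b,\mathbf A)\|_F^2+\langle\boldsymbol\Lambda,\mathbf W-\mathbf U\rangle+\tfrac\mu2\|\mathbf W-\mathbf U\|_F^2+\langle\boldsymbol\Gamma,\mathbf W-\mathbf V\rangle+\tfrac\nu2\|\mathbf W-\mathbf V\|_F^2.$$ ADMM for the elastic-net model generates, from an arbitrary starting point, $\mathbf z_1^{(k)}=(\mathbf W^{(k)},\mathbf b^{(k)},\mathbf A^{(k)},\mathbf U^{(k)},\boldsymbol\Pi^{(k)},\boldsymbol\Lambda^{(k)})$, $k\ge0$, as follows: $(\mathbf W^{(k+1)},\mathbf b^{(k+1)})$ minimizes $\mathcal L_1(\cdot,\cdot,\mathbf A^{(k)},\mathbf U^{(k)},\boldsymbol\Pi^{(k)},\boldsymbol\Lambda^{(k)})$ over $\mathcal D$; $(\mathbf A^{(k+1)},\mathbf U^{(k+1)})$ minimizes $\mathcal L_1(\mathbf W^{(k+1)},\mathbf b^{(k+1)},\cdot,\cdot,\boldsymbol\Pi^{(k)},\boldsymbol\Lambda^{(k)})$;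 $\boldsymbol\Pi^{(k+1)}=\boldsymbol\Pi^{(k)}+\alpha\mathbf R(\mathbf W^{(k+1)},\mathbf b^{(k+1)},\mathbf A^{(k+1)})$; $\boldsymbol\Lambda^{(k+1)}=\boldsymbol\Lambda^{(k)}+\mu(\mathbf W^{(k+1)}-\mathbf U^{(k+1)})$. ADMM for the group-lasso and supnorm models generates in the same way $\mathbf z_2^{(k)}=(\mathbf W^{(k)},\mathbf b^{(k)},\mathbf A^{(k)},\mathbf U^{(k)},\mathbf V^{(k)},\boldsymbol\Pi^{(k)},\boldsymbol\Lambda^{(k)},\boldsymbol\Gamma^{(k)})$ with $\mathcal L_2$ in place of $\mathcal L_1$, $(\mathbf A,\mathbf U,\mathbf V)$ in place of $(\mathbf A,\mathbf U)$, and the further update $\boldsymbol\Gamma^{(k+1)}=\boldsymbol\Gamma^{(k)}+\nu(\mathbf W^{(k+1)}-\mathbf V^{(k+1)})$. Then both minima $F_1^*$ and $F_2^*$ exist, and for every sequence $\{\mathbf z_1^{(k)}\}$ and every sequence $\{\mathbf z_2^{(k)}\}$ so generated: 1. $F_1(\mathbf W^{(k)},\mathbf b^{(k)},\mathbf A^{(k)},\mathbf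 U^{(k)})\to F_1^*$ along $\{\mathbf z_1^{(k)}\}$, and $F_2(\mathbf W^{(k)},\mathbf b^{(k)},\mathbf A^{(k)},\mathbf U^{(k)},\mathbf V^{(k)})\to F_2^*$ along $\{\mathbf z_2^{(k)}\}$; 2. $\|\mathbf X^\top\mathbf W^{(k)}+\mathbf e(\mathbf b^{(k)})^\top+\mathbf E-\mathbf A^{(k)}\|_F\to0$ and $\|\mathbf W^{(k)}-\mathbf U^{(k)}\|_F\to0$ along both sequences, and $\|\mathbf W^{(k)}-\mathbf V^{(k)}\|_F\to0$ along $\{\mathbf z_2^{(k)}\}$; 3. if in addition $\lambda_2>0$ and $\lambda_3>0$ in the elastic-net model, then $\{\mathbf z_1^{(k)}\}$ converges linearly: there are a limit $\mathbf z_1^*$ and constants $C$ and $\rho\in(0,1)$ with $\|\mathbf z_1^{(k)}-\mathbf z_1^*\|\le C\rho^k$ for all $k\ge0$, in the Euclidean norm of all six components. -/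

import Mathlib

/- In everything below the norm of a matrix is the Frobenius norm. -/
open scoped Matrix Matrix.Norms.Frobenius ENNReal Topology
open Filter

namespace MSVM

noncomputable section

/-- The data of a regularized multiclass SVM: `n` samples in dimension `p` (the columns of `X`),
their labels `y` among `J` classes, and the three regularization weights. -/
structure Model (n p J : ℕ) where
  X : Matrix (Fin p) (Fin n) ℝ
  y : Fin n → Fin J
  lam1 : ℝ
  lam2 : ℝ
  lam3 : ℝ

variable {n p J : ℕ}

/-- The Frobenius inner product `⟨M, N⟩ = tr (Mᵀ N)`. -/
def frobInner {m l : ℕ} (M N : Matrix (Fin m) (Fin l) ℝ) : ℝ := (Mᵀ * N).trace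

/-- The entrywise norm `‖M‖₁ = ∑ |m_ij|`. -/
def l1Norm {m l : ℕ} (M : Matrix (Fin m) (Fin l) ℝ) : ℝ := ∑ i, ∑ j, |M i j|

/-- The Euclidean norm `‖b‖₂`. -/
def l2Norm {m : ℕ} (b : Fin m → ℝ) : ℝ := ‖(WithLp.toLp 2 b : EuclideanSpace ℝ (Fin m))‖

/-- The sum `∑ ‖vʲ‖_q` of the `ℓ_q` norms of the rows of `V`. -/
def rowNormSum {m l : ℕ} (q : ℝ≥0∞) (V : Matrix (Fin m) (Fin l) ℝ) : ℝ :=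
  ∑ j, ‖(WithLp.toLp q (V j) : PiLp q (fun _ : Fin l => ℝ))‖

/-- The cost `c_ij`: one if `y_i ≠ j`, zero otherwise. -/
def Model.c (M : Model n p J) (i : Fin n) (j : Fin J) : ℝ := if M.y i ≠ j then 1 else 0

/-- The loss `(1/n) ∑ c_ij [a_ij]₊`. -/
def Model.loss (M : Model n p J) (A : Matrix (Fin n) (Fin J) ℝ) : ℝ :=
  (1 / (n : ℝ)) * ∑ i, ∑ j, M.c i j * max 0 (A i j)

/-- The residual `Xᵀ W + e bᵀ + E - A` of the first constraint. -/
def Model.res (M : Model n p J) (W : Matrix (Fin p) (Fin J) ℝ) (b : Fin J → ℝ)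
    (A : Matrix (Fin n) (Fin J) ℝ) : Matrix (Fin n) (Fin J) ℝ :=
  M.Xᵀ * W + Matrix.vecMulVec 1 b + Matrix.of (fun _ _ => 1) - A

/-- The set `𝒟` of the pairs `(W, b)` with `W e = 0` and `eᵀ b = 0`. -/
def D (p J : ℕ) : Set (Matrix (Fin p) (Fin J) ℝ × (Fin J → ℝ)) :=
  {x | x.1 *ᵥ 1 = 0 ∧ 1 ⬝ᵥ x.2 = 0}

/-! ### The elastic-net model -/

/-- The objective of the split elastic-net problem. -/
def Model.F1 (M : Model n p J) (W : Matrix (Fin p) (Fin J) ℝ) (b : Fin J → ℝ)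
    (A : Matrix (Fin n) (Fin J) ℝ) (U : Matrix (Fin p) (Fin J) ℝ) : ℝ :=
  M.loss A + M.lam1 * l1Norm U + M.lam2 / 2 * ‖W‖ ^ 2 + M.lam3 / 2 * l2Norm b ^ 2

/-- The objective values of the split elastic-net problem at its feasible points. -/
def Model.values1 (M : Model n p J) : Set ℝ :=
  {t | ∃ W b A U, (W, b) ∈ D p J ∧ A = M.Xᵀ * W + Matrix.vecMulVec 1 b + Matrix.of (fun _ _ => 1) ∧
    U = W ∧ t = M.F1 W b A U}

/-- The augmented Lagrangian of the split elastic-net problem. -/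
def Model.L1 (M : Model n p J) (α μ : ℝ) (W : Matrix (Fin p) (Fin J) ℝ) (b : Fin J → ℝ)
    (A : Matrix (Fin n) (Fin J) ℝ) (U : Matrix (Fin p) (Fin J) ℝ)
    (Pm : Matrix (Fin n) (Fin J) ℝ) (Lm : Matrix (Fin p) (Fin J) ℝ) : ℝ :=
  M.F1 W b A U + frobInner Lm (W - U) + μ / 2 * ‖W - U‖ ^ 2
    + frobInner Pm (M.res W b A) + α / 2 * ‖M.res W b A‖ ^ 2

/-- The tuples `(W, b, A, U, Π, Λ)`. -/
structure State1 (n p J : ℕ) where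
  W : Matrix (Fin p) (Fin J) ℝ
  b : Fin J → ℝ
  A : Matrix (Fin n) (Fin J) ℝ
  U : Matrix (Fin p) (Fin J) ℝ
  Pm : Matrix (Fin n) (Fin J) ℝ
  Lm : Matrix (Fin p) (Fin J) ℝ

/-- The Euclidean distance of two tuples. -/
def State1.distance (z w : State1 n p J) : ℝ :=
  √(‖z.W - w.W‖ ^ 2 + l2Norm (z.b - w.b) ^ 2 + ‖z.A - w.A‖ ^ 2 + ‖z.U - w.U‖ ^ 2
    + ‖z.Pm - w.Pm‖ ^ 2 + ‖z.Lm - w.Lm‖ ^ 2)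

/-- One ADMM iteration for the elastic-net model, from `z` to `z'`. -/
structure Model.Step1 (M : Model n p J) (α μ : ℝ) (z z' : State1 n p J) : Prop where
  mem_D : (z'.W, z'.b) ∈ D p J
  min_Wb : ∀ W b, (W, b) ∈ D p J →
    M.L1 α μ z'.W z'.b z.A z.U z.Pm z.Lm ≤ M.L1 α μ W b z.A z.U z.Pm z.Lm
  min_AU : ∀ A U, M.L1 α μ z'.W z'.b z'.A z'.U z.Pm z.Lm ≤ M.L1 α μ z'.W z'.b A U z.Pm z.Lm
  update_Pm : z'.Pm = z.Pm + α • M.res z'.W z'.b z'.A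
  update_Lm : z'.Lm = z.Lm + μ • (z'.W - z'.U)

/-- Linear convergence (in the root sense) of a sequence of tuples to some limit. -/
def ConvergesLinearly (z : ℕ → State1 n p J) : Prop :=
  ∃ (w : State1 n p J) (C ρ : ℝ), 0 < ρ ∧ ρ < 1 ∧ ∀ k, (z k).distance w ≤ C * ρ ^ k

/-! ### The group-lasso (`q = 2`) and supnorm (`q = ∞`) models -/

/-- The objective of the split problem with the row-norm regularizer. -/
def Model.F2 (M : Model n p J) (q : ℝ≥0∞) (_W : Matrix (Fin p) (Fin J) ℝ) (b : Fin J → ℝ)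
    (A : Matrix (Fin n) (Fin J) ℝ) (U V : Matrix (Fin p) (Fin J) ℝ) : ℝ :=
  M.loss A + M.lam1 * l1Norm U + M.lam2 * rowNormSum q V + M.lam3 / 2 * l2Norm b ^ 2

/-- The objective values of that split problem at its feasible points. -/
def Model.values2 (M : Model n p J) (q : ℝ≥0∞) : Set ℝ :=
  {t | ∃ W b A U V, (W, b) ∈ D p J ∧
    A = M.Xᵀ * W + Matrix.vecMulVec 1 b + Matrix.of (fun _ _ => 1) ∧
    U = W ∧ V = W ∧ t = M.F2 q W b A U V}

/-- The augmented Lagrangian of that split problem. -/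
def Model.L2 (M : Model n p J) (q : ℝ≥0∞) (α μ ν : ℝ) (W : Matrix (Fin p) (Fin J) ℝ)
    (b : Fin J → ℝ) (A : Matrix (Fin n) (Fin J) ℝ) (U V : Matrix (Fin p) (Fin J) ℝ)
    (Pm : Matrix (Fin n) (Fin J) ℝ) (Lm Gm : Matrix (Fin p) (Fin J) ℝ) : ℝ :=
  M.F2 q W b A U V + frobInner Pm (M.res W b A) + α / 2 * ‖M.res W b A‖ ^ 2
    + frobInner Lm (W - U) + μ / 2 * ‖W - U‖ ^ 2
    + frobInner Gm (W - V) + ν / 2 * ‖W - V‖ ^ 2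

/-- The tuples `(W, b, A, U, V, Π, Λ, Γ)`. -/
structure State2 (n p J : ℕ) where
  W : Matrix (Fin p) (Fin J) ℝ
  b : Fin J → ℝ
  A : Matrix (Fin n) (Fin J) ℝ
  U : Matrix (Fin p) (Fin J) ℝ
  V : Matrix (Fin p) (Fin J) ℝ
  Pm : Matrix (Fin n) (Fin J) ℝ
  Lm : Matrix (Fin p) (Fin J) ℝ
  Gm : Matrix (Fin p) (Fin J) ℝ

/-- One ADMM iteration for the model with the row-norm regularizer, from `z` to `z'`. -/
structure Model.Step2 (M : Model n p J) (q : ℝ≥0∞) (α μ ν : ℝ) (z z' : State2 n p J) : Prop where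
  mem_D : (z'.W, z'.b) ∈ D p J
  min_Wb : ∀ W b, (W, b) ∈ D p J →
    M.L2 q α μ ν z'.W z'.b z.A z.U z.V z.Pm z.Lm z.Gm ≤ M.L2 q α μ ν W b z.A z.U z.V z.Pm z.Lm z.Gm
  min_AUV : ∀ A U V,
    M.L2 q α μ ν z'.W z'.b z'.A z'.U z'.V z.Pm z.Lm z.Gm
      ≤ M.L2 q α μ ν z'.W z'.b A U V z.Pm z.Lm z.Gm
  update_Pm : z'.Pm = z.Pm + α • M.res z'.W z'.b z'.A
  update_Lm : z'.Lm = z.Lm + μ • (z'.W - z'.U)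
  update_Gm : z'.Gm = z.Gm + ν • (z'.W - z'.V)

end

end MSVM

/-!
Both algorithms are the two-block ADMM for minimizing `‖G x‖ ^ 2 / 2 + θ (B x + c)` over a
finite-dimensional space (here the pairs `x = (W, b)` in `𝒟`), with `θ` convex and finite
everywhere. Writing the split variables as `y = (√α A, √μ U)` or `y = (√α A, √μ U, √ν V)` and the
multipliers as `u = (Π / √α, Λ / √μ)` or `u = (Π / √α, Λ / √μ, Γ / √ν)` turns all penalty
parameters into one (`L1_eq`, `L2_eq`), so that the iteration is `IsADMMStep`.

*Attainment.* The weights may vanish, and the hinge loss is constant along unbounded directions, so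
the objective need not be coercive. It is a sum of hinge functions and a term with bounded sublevel
sets in the variables that it controls. `exists_conformal_preimage` moves any point to a bounded
one without increasing the objective (`exists_forall_le_of_hinge`), which leaves a minimization
over a ball. A minimizer has a multiplier by separation (`exists_isKKT`).

*Convergence.* Against any solution of the Karush–Kuhn–Tucker conditions, `‖y - y*‖² + ‖u - u*‖²`
decreases by at least `‖u' - u‖² + ‖y' - y‖² + 2 ‖G (x' - x*)‖²` (`IsADMMStep.fejer`). Hence the
residual `u' - u` vanishes, and the objective is squeezed to its minimum
(`tendsto_of_isADMMStep`).

*Linear rate.* For positive `λ₂` and `λ₃` the primal solution is unique, so `y` converges to `y*`.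
As `θ` is polyhedral, the multipliers are eventually subgradients at `y*` itself, that is, they lie
in a fixed box, and the only defect left is in the linear equation `Bᵀ u = -∇`, which the decrease
above controls. A Hoffman bound, again from `exists_conformal_preimage`, then bounds the distance to
the set of multipliers by the decrease, and `‖y - y*‖² + dist(u, multipliers)²` contracts
(`exists_linear_rate`). Geometrically decaying steps give the limit of `u`.
-/

namespace MSVM

/-! ### Conformal preimages and attainment -/

/-- On an orthant face `{k | |k i| = σ i * k i}` that meets the kernel of `A` only in `0`, the
linear map `A` is bounded below. -/
theorem exists_bound_on_sign_cone {ι F : Type*} [Fintype ι] [NormedAddCommGroup F]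
    [NormedSpace ℝ F] (A : (ι → ℝ) →ₗ[ℝ] F) (σ : ι → SignType)
    (hσ : ∀ k : ι → ℝ, (∀ i, |k i| = (σ i : ℝ) * k i) → A k = 0 → k = 0) :
    ∃ κ : ℝ, 0 ≤ κ ∧ ∀ k : ι → ℝ, (∀ i, |k i| = (σ i : ℝ) * k i) → ‖k‖ ≤ κ * ‖A k‖ := by
  have hAc : Continuous A := A.continuous_of_finiteDimensional
  set T : Set (ι → ℝ) := {k | ∀ i, |k i| = (σ i : ℝ) * k i} ∩ Metric.sphere 0 1 with hT
  have hTc : IsCompact T := by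
    refine (isCompact_sphere 0 1).inter_left ?_
    simp only [Set.ofPred_forall]
    exact isClosed_iInter fun i => isClosed_eq (by fun_prop) (by fun_prop)
  have hnorm : ∀ k : ι → ℝ, (∀ i, |k i| = (σ i : ℝ) * k i) → k ≠ 0 → ‖k‖⁻¹ • k ∈ T := by
    intro k hk hk0
    refine ⟨fun i => ?_, ?_⟩
    · simp only [Pi.smul_apply, smul_eq_mul, abs_mul, hk i, abs_inv, abs_norm]
      ring
    · simp [norm_smul, hk0]
  rcases T.eq_empty_or_nonempty with hTe | hTne
  · refine ⟨0, le_rfl, fun k hk => ?_⟩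
    by_cases hk0 : k = 0
    · simp [hk0]
    · have := hnorm k hk hk0
      simp [hTe] at this
  · obtain ⟨k₀, hk₀, hmin⟩ := hTc.exists_isMinOn hTne (hAc.norm.continuousOn)
    have hpos : 0 < ‖A k₀‖ := by
      rw [norm_pos_iff]
      intro h0
      have := hσ k₀ hk₀.1 h0
      have h1 := hk₀.2
      simp [this] at h1
    refine ⟨‖A k₀‖⁻¹, by positivity, fun k hk => ?_⟩
    by_cases hk0 : k = 0
    · simp [hk0]
    · have h := isMinOn_iff.1 hmin _ (hnorm k hk hk0)
      have hkp : 0 < ‖k‖ := norm_pos_iff.2 hk0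
      simp only [map_smul, norm_smul, norm_inv, norm_norm] at h
      rw [inv_mul_eq_div, le_div_iff₀ hpos]
      rw [inv_mul_eq_div, le_div_iff₀ hkp] at h
      linarith

/-- A linear map on `ℝ^ι` has preimages that are bounded by the image and conformal to a given
preimage. This is the one polyhedral fact of the development: it gives both the attainment of
the minima and a Hoffman error bound. -/
theorem exists_conformal_preimage {ι F : Type*} [Fintype ι] [NormedAddCommGroup F]
    [NormedSpace ℝ F] (A : (ι → ℝ) →ₗ[ℝ] F) :
    ∃ κ : ℝ, 0 ≤ κ ∧ ∀ w : ι → ℝ, ∃ c : ι → ℝ,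
      (∀ i, c i ∈ Set.uIcc 0 (w i)) ∧ A c = A w ∧ ‖c‖ ≤ κ * ‖A w‖ := by
  classical
  have hAc : Continuous A := A.continuous_of_finiteDimensional
  have hκ : ∀ σ : ι → SignType, ∃ κ : ℝ, 0 ≤ κ ∧
      ((∀ k : ι → ℝ, (∀ i, |k i| = (σ i : ℝ) * k i) → A k = 0 → k = 0) →
        ∀ k : ι → ℝ, (∀ i, |k i| = (σ i : ℝ) * k i) → ‖k‖ ≤ κ * ‖A k‖) := by
    intro σ
    by_cases h : ∀ k : ι → ℝ, (∀ i, |k i| = (σ i : ℝ) * k i) → A k = 0 → k = 0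
    · obtain ⟨κ, h0, hk⟩ := exists_bound_on_sign_cone A σ h
      exact ⟨κ, h0, fun _ => hk⟩
    · exact ⟨0, le_rfl, fun h' => absurd h' h⟩
  choose κ hκ0 hκ using hκ
  refine ⟨∑ σ, κ σ, Finset.sum_nonneg fun σ _ => hκ0 σ, fun w => ?_⟩
  -- A conformal preimage of least `ℓ₁` norm has no kernel vector conformal to it.
  set P : Set (ι → ℝ) := (Set.univ.pi fun i => Set.uIcc 0 (w i)) ∩ {c | A c = A w} with hP
  have hPc : IsCompact P :=
    (isCompact_univ_pi fun i => isCompact_uIcc).inter_right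
      (isClosed_eq hAc continuous_const)
  have hwP : w ∈ P := ⟨fun i _ => Set.right_mem_uIcc, rfl⟩
  obtain ⟨c, hcP, hmin⟩ := hPc.exists_isMinOn ⟨w, hwP⟩
    (f := fun c : ι → ℝ => ∑ i, |c i|) (by fun_prop)
  refine ⟨c, fun i => hcP.1 i trivial, hcP.2, ?_⟩
  have hker : ∀ k : ι → ℝ, (∀ i, |k i| = (SignType.sign (c i) : ℝ) * k i) → A k = 0 → k = 0 := by
    intro k hk hAk
    have hev : ∀ᶠ t in 𝓝[>] (0 : ℝ), ∀ i, t * |k i| ≤ |c i| := by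
      refine eventually_all.2 fun i => ?_
      by_cases hci : c i = 0
      · have : |k i| = 0 := by rw [hk i]; simp [hci]
        simp [this]
      · have : Tendsto (fun t : ℝ => t * |k i|) (𝓝[>] 0) (𝓝 (0 * |k i|)) :=
          ((continuous_id.mul continuous_const).tendsto 0).mono_left nhdsWithin_le_nhds
        rw [zero_mul] at this
        exact (this.eventually_lt_const (abs_pos.2 hci)).mono fun t ht => ht.le
    obtain ⟨t, hle, ht⟩ := (hev.and self_mem_nhdsWithin).exists
    have ht : 0 < t := ht
    have hcoord : ∀ i, |c i - t * k i| = |c i| - t * |k i| ∧ c i - t * k i ∈ Set.uIcc 0 (w i) := by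
      intro i
      have h1 := hk i
      have h2 := hle i
      have h3 := hcP.1 i trivial
      rw [Set.mem_uIcc] at h3 ⊢
      rcases lt_trichotomy (c i) 0 with h | h | h
      · rw [sign_neg h] at h1
        simp only [SignType.coe_neg_one, neg_mul, one_mul] at h1
        rw [abs_of_neg h, h1] at h2
        have hk0 : 0 ≤ -k i := h1 ▸ abs_nonneg _
        have := mul_nonneg ht.le hk0
        refine ⟨by rw [abs_of_nonpos (by linarith), abs_of_neg h, h1]; ring, ?_⟩
        rcases h3 with h3 | h3
        · linarith [h3.1]
        · exact Or.inr ⟨by linarith, by linarith⟩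
      · rw [h] at h1
        simp only [sign_zero, SignType.coe_zero, zero_mul, abs_eq_zero] at h1
        refine ⟨by simp [h, h1], ?_⟩
        simpa [h, h1] using h3
      · rw [sign_pos h] at h1
        simp only [SignType.coe_one, one_mul] at h1
        rw [abs_of_pos h, h1] at h2
        have hk0 : 0 ≤ k i := h1 ▸ abs_nonneg _
        have := mul_nonneg ht.le hk0
        refine ⟨by rw [abs_of_nonneg (by linarith), abs_of_pos h, h1], ?_⟩
        rcases h3 with h3 | h3
        · exact Or.inl ⟨by linarith, by linarith⟩
        · linarith [h3.2]
    have hmem : (fun i => c i - t * k i) ∈ P := by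
      refine ⟨fun i _ => (hcoord i).2, ?_⟩
      have : (fun i => c i - t * k i) = c - t • k := by ext i; simp
      simp only [Set.mem_ofPred_eq, this, map_sub, map_smul, hAk, smul_zero, sub_zero]
      exact hcP.2
    have h := isMinOn_iff.1 hmin _ hmem
    simp only [(hcoord _).1, Finset.sum_sub_distrib, ← Finset.mul_sum] at h
    have hs : ∑ i, |k i| ≤ 0 := by
      by_contra hs
      push Not at hs
      have := mul_pos ht hs
      linarith
    have hs0 := (Finset.sum_eq_zero_iff_of_nonneg fun i _ => abs_nonneg (k i)).1
      (le_antisymm hs (Finset.sum_nonneg fun i _ => abs_nonneg (k i)))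
    ext i
    simpa using hs0 i (Finset.mem_univ i)
  calc ‖c‖ ≤ κ (fun i => SignType.sign (c i)) * ‖A c‖ :=
        hκ _ hker c fun i => (sign_mul_self (c i)).symm
    _ ≤ (∑ σ, κ σ) * ‖A w‖ := by
        rw [show A c = A w from hcP.2]
        gcongr
        exact Finset.single_le_sum (f := κ) (fun σ _ => hκ0 σ) (Finset.mem_univ _)

/-- Attainment for sums of hinge functions and a term `H` that factors through a linear map `L`
on which its sublevel sets are bounded. No coercivity is assumed: along the remaining directions
the objective is polyhedral. -/
theorem exists_forall_le_of_hinge {X F ι : Type*} [Fintype ι]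
    [NormedAddCommGroup X] [NormedSpace ℝ X] [FiniteDimensional ℝ X]
    [NormedAddCommGroup F] [NormedSpace ℝ F]
    (L : X →ₗ[ℝ] F) (ℓ : X →ₗ[ℝ] (ι → ℝ)) (a ω : ι → ℝ) (hω : ∀ i, 0 ≤ ω i)
    (H f : X → ℝ) (hf : Continuous f) (hfH : ∀ x, f x = H x + ∑ i, ω i * max 0 (ℓ x i + a i))
    (hH0 : ∀ x, 0 ≤ H x) (hHL : ∀ x x', L x' = L x → H x' = H x)
    (hHb : ∀ K, ∃ R, ∀ x, H x ≤ K → ‖L x‖ ≤ R) :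
    ∃ x₀, ∀ x, f x₀ ≤ f x := by
  classical
  set e : X ≃ₗ[ℝ] (Fin (Module.finrank ℝ X) → ℝ) := (Module.finBasis ℝ X).equivFun with he
  -- `A (x, m) = (L x, ω (ℓ x + m))`, in coordinates.
  let d := Module.finrank ℝ X
  let p₁ : (Fin d ⊕ ι → ℝ) →ₗ[ℝ] X := e.symm.toLinearMap ∘ₗ LinearMap.funLeft ℝ ℝ Sum.inl
  let A : (Fin d ⊕ ι → ℝ) →ₗ[ℝ] F × (ι → ℝ) :=
    (L ∘ₗ p₁).prod (LinearMap.pi fun i =>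
      ω i • (LinearMap.proj i ∘ₗ ℓ ∘ₗ p₁ + LinearMap.proj (Sum.inr i)))
  have hA1 : ∀ v, (A v).1 = L (p₁ v) := fun v => rfl
  have hA2 : ∀ v i, (A v).2 i = ω i * (ℓ (p₁ v) i + v (Sum.inr i)) := fun v i => rfl
  obtain ⟨κ, hκ0, hκ⟩ := exists_conformal_preimage A
  have hsum0 : ∀ x, 0 ≤ ∑ i, ω i * max 0 (ℓ x i + a i) := fun x =>
    Finset.sum_nonneg fun i _ => mul_nonneg (hω i) (le_max_left _ _)
  obtain ⟨R, hR⟩ := hHb (f 0)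
  set p₁c := LinearMap.toContinuousLinearMap p₁ with hp₁c
  set S : ℝ := ‖p₁c‖ * (κ * max R (|f 0| + ∑ i, |ω i * a i|)) with hS
  have key : ∀ x, f x ≤ f 0 → ∃ x', ‖x'‖ ≤ S ∧ f x' ≤ f x := by
    intro x hx
    have hHx : H x ≤ f 0 := by linarith [hfH x, hsum0 x]
    let w : Fin d ⊕ ι → ℝ := Sum.elim (e x) fun i => max 0 (ℓ x i + a i) - (ℓ x i + a i)
    have hpw : p₁ w = x := by
      simp only [p₁, LinearMap.comp_apply]
      have : LinearMap.funLeft ℝ ℝ Sum.inl w = e x := by ext i; rfl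
      rw [this]
      exact e.symm_apply_apply x
    obtain ⟨c, hcw, hAc, hcn⟩ := hκ w
    have hw2 : ∀ i, (A w).2 i = ω i * max 0 (ℓ x i + a i) - ω i * a i := by
      intro i
      rw [hA2, hpw]
      simp only [w, Sum.elim_inr]
      ring
    have hAw : ‖A w‖ ≤ max R (|f 0| + ∑ i, |ω i * a i|) := by
      rw [Prod.norm_def]
      refine max_le_max ?_ ?_
      · rw [hA1, hpw]; exact hR x hHx
      · refine (pi_norm_le_iff_of_nonneg
          (add_nonneg (abs_nonneg _) (Finset.sum_nonneg fun i _ => abs_nonneg _))).2 fun i => ?_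
        rw [hw2, Real.norm_eq_abs]
        refine (abs_sub _ _).trans (add_le_add ?_ ?_)
        · rw [abs_of_nonneg (mul_nonneg (hω i) (le_max_left _ _))]
          refine le_trans ?_ (le_abs_self _)
          have := Finset.single_le_sum (f := fun i => ω i * max 0 (ℓ x i + a i))
            (fun i _ => mul_nonneg (hω i) (le_max_left _ _)) (Finset.mem_univ i)
          linarith [hfH x, hH0 x]
        · exact Finset.single_le_sum (f := fun i => |ω i * a i|)
            (fun i _ => abs_nonneg _) (Finset.mem_univ i)
    refine ⟨p₁ c, ?_, ?_⟩
    · calc ‖p₁ c‖ = ‖p₁c c‖ := rfl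
        _ ≤ ‖p₁c‖ * ‖c‖ := p₁c.le_opNorm c
        _ ≤ S := by
          rw [hS]
          gcongr
          exact hcn.trans (by gcongr)
    · have h1 : L (p₁ c) = L x := by rw [← hA1, hAc, hA1, hpw]
      rw [hfH, hfH, hHL x _ h1]
      refine add_le_add le_rfl (Finset.sum_le_sum fun i _ => ?_)
      have h2 : ω i * (ℓ (p₁ c) i + c (Sum.inr i))
          = ω i * max 0 (ℓ x i + a i) - ω i * a i := by
        rw [← hA2, hAc, hw2]
      have h3 : 0 ≤ c (Sum.inr i) := by
        have := hcw (Sum.inr i)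
        rw [Set.uIcc_of_le] at this
        · exact this.1
        · simp [w]
      rw [mul_max_of_nonneg _ _ (hω i), mul_zero]
      refine max_le (mul_nonneg (hω i) (le_max_left _ _)) ?_
      have := mul_nonneg (hω i) h3
      linarith
  have hS0 : 0 ≤ S := by
    obtain ⟨x', hx', -⟩ := key 0 le_rfl
    exact (norm_nonneg _).trans hx'
  have : ProperSpace X := FiniteDimensional.proper ℝ X
  obtain ⟨x₀, -, hmin⟩ := (isCompact_closedBall (0 : X) S).exists_isMinOn
    ⟨0, by simpa using hS0⟩ hf.continuousOn
  refine ⟨x₀, fun x => ?_⟩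
  rcases le_total (f x) (f 0) with hx | hx
  · obtain ⟨x', hx'S, hx'⟩ := key x hx
    exact (isMinOn_iff.1 hmin x' (by simpa using hx'S)).trans hx'
  · exact (isMinOn_iff.1 hmin 0 (by simpa using hS0)).trans hx

/-! ### Two-block ADMM -/

section ADMM

variable {X Y Z : Type*} [AddCommGroup X] [Module ℝ X]
  [NormedAddCommGroup Y] [InnerProductSpace ℝ Y] [NormedAddCommGroup Z] [InnerProductSpace ℝ Z]

/-- `u` is a subgradient of `θ` at `y`. -/
def IsSubgradient (θ : Y → ℝ) (y u : Y) : Prop := ∀ y', θ y + inner ℝ u (y' - y) ≤ θ y'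

/-- The Karush–Kuhn–Tucker conditions, at the primal point `x` and the multiplier `u`, for the
minimization of `‖G x‖ ^ 2 / 2 + θ (B x + c)`. -/
structure IsKKT (B : X →ₗ[ℝ] Y) (G : X →ₗ[ℝ] Z) (c : Y) (θ : Y → ℝ) (x : X) (u : Y) : Prop where
  stationary : ∀ d, inner ℝ (G x) (G d) + inner ℝ u (B d) = 0
  subgradient : IsSubgradient θ (B x + c) u

/-- One iteration of ADMM, with scaled multiplier `u` and unit penalty, for the minimization of
`‖G x‖ ^ 2 / 2 + θ y` subject to `y = B x + c`. It depends on the previous iterate through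
`(y, u)` only. -/
structure IsADMMStep (B : X →ₗ[ℝ] Y) (G : X →ₗ[ℝ] Z) (c : Y) (θ : Y → ℝ) (y u : Y) (x' : X)
    (y' u' : Y) : Prop where
  min_x : ∀ x, ‖G x'‖ ^ 2 / 2 + ‖B x' + c - y + u‖ ^ 2 / 2
    ≤ ‖G x‖ ^ 2 / 2 + ‖B x + c - y + u‖ ^ 2 / 2
  min_y : ∀ v, θ y' + ‖B x' + c - y' + u‖ ^ 2 / 2 ≤ θ v + ‖B x' + c - v + u‖ ^ 2 / 2
  update : u' = u + (B x' + c - y')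

theorem nonneg_of_forall_add_mul_nonneg {a b : ℝ} (h : ∀ t, 0 < t → t ≤ 1 → 0 ≤ a + t * b) :
    0 ≤ a := by
  have : Tendsto (fun t : ℝ => a + t * b) (𝓝[>] 0) (𝓝 (a + 0 * b)) :=
    ((by fun_prop : Continuous fun t : ℝ => a + t * b).tendsto 0).mono_left nhdsWithin_le_nhds
  rw [zero_mul, add_zero] at this
  refine ge_of_tendsto this ?_
  filter_upwards [Ioc_mem_nhdsGT (zero_lt_one' ℝ)] with t ht using h t ht.1 ht.2

/-- First-order optimality for a convex function plus a least-squares term. -/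
theorem le_add_inner_of_isMin {E : Type*} [AddCommGroup E] [Module ℝ E] {f : E → ℝ}
    (hf : ConvexOn ℝ Set.univ f) (T : E →ₗ[ℝ] Y) (w : Y) {x : E}
    (hmin : ∀ v, f x + ‖T x + w‖ ^ 2 / 2 ≤ f v + ‖T v + w‖ ^ 2 / 2) (v : E) :
    f x ≤ f v + inner ℝ (T x + w) (T (v - x)) := by
  have key : ∀ t : ℝ, 0 < t → t ≤ 1 →
      0 ≤ (f v + inner ℝ (T x + w) (T (v - x)) - f x) + t * (‖T (v - x)‖ ^ 2 / 2) := by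
    intro t ht ht1
    have h1 := hmin (x + t • (v - x))
    have h2 : f (x + t • (v - x)) ≤ (1 - t) * f x + t * f v := by
      have := hf.2 (Set.mem_univ x) (Set.mem_univ v) (sub_nonneg.2 ht1) ht.le (by ring)
      simp only [smul_eq_mul] at this
      rwa [show (1 - t) • x + t • v = x + t • (v - x) by module] at this
    have h3 : T (x + t • (v - x)) + w = (T x + w) + t • T (v - x) := by
      rw [map_add, map_smul]; abel
    rw [h3, norm_add_sq_real (T x + w), inner_smul_right, norm_smul, mul_pow, Real.norm_eq_abs,
      sq_abs] at h1
    have h4 : 0 ≤ t * ((f v + inner ℝ (T x + w) (T (v - x)) - f x)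
        + t * (‖T (v - x)‖ ^ 2 / 2)) := by nlinarith
    exact nonneg_of_mul_nonneg_right h4 ht
  linarith [nonneg_of_forall_add_mul_nonneg key]

theorem convexOn_half_norm_sq {E : Type*} [AddCommGroup E] [Module ℝ E] (G : E →ₗ[ℝ] Z) :
    ConvexOn ℝ Set.univ fun x => ‖G x‖ ^ 2 / 2 := by
  refine ⟨convex_univ, fun x _ y _ a b ha hb hab => ?_⟩
  have hb' : b = 1 - a := by linarith
  subst hb'
  simp only [smul_eq_mul, map_add, map_smul]
  rw [norm_add_sq_real, inner_smul_left, inner_smul_right, norm_smul, norm_smul, mul_pow, mul_pow,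
    Real.norm_eq_abs, Real.norm_eq_abs, sq_abs, sq_abs]
  have := norm_sub_sq_real (G x) (G y)
  simp only [conj_trivial]
  have h2 : 0 ≤ a * (1 - a) * ‖G x - G y‖ ^ 2 := by positivity
  rw [this] at h2
  nlinarith

variable {B : X →ₗ[ℝ] Y} {G : X →ₗ[ℝ] Z} {c : Y} {θ : Y → ℝ}

theorem IsSubgradient.monotone {y₁ y₂ u₁ u₂ : Y} (h₁ : IsSubgradient θ y₁ u₁)
    (h₂ : IsSubgradient θ y₂ u₂) : 0 ≤ inner ℝ (u₁ - u₂) (y₁ - y₂) := by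
  have a := h₁ y₂
  have b := h₂ y₁
  rw [← neg_sub y₁ y₂, inner_neg_right] at a
  rw [inner_sub_left]
  linarith

namespace IsADMMStep

variable {y u y' u' : Y} {x' : X}

theorem stationary (h : IsADMMStep B G c θ y u x' y' u') (d : X) :
    inner ℝ (G x') (G d) + inner ℝ (u' + (y' - y)) (B d) = 0 := by
  have hle : ∀ v, 0 ≤ inner ℝ (G x') (G (v - x')) + inner ℝ (u' + (y' - y)) (B (v - x')) := by
    intro v
    have h1 := le_add_inner_of_isMin (convexOn_half_norm_sq G) B (c - y + u) (x := x')
      (fun v => by simpa only [add_assoc, add_sub_assoc] using h.min_x v)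
    have h2 : B x' + (c - y + u) = u' + (y' - y) := by rw [h.update]; abel
    rw [h2] at h1
    have key : ∀ t : ℝ, 0 < t → t ≤ 1 → 0 ≤ (inner ℝ (G x') (G (v - x'))
        + inner ℝ (u' + (y' - y)) (B (v - x'))) + t * (‖G (v - x')‖ ^ 2 / 2) := by
      intro t ht _
      have h3 := h1 (x' + t • (v - x'))
      rw [map_add, map_smul, norm_add_sq_real, inner_smul_right, norm_smul, mul_pow,
        Real.norm_eq_abs, sq_abs, add_sub_cancel_left, map_smul, inner_smul_right] at h3
      have h4 : 0 ≤ t * ((inner ℝ (G x') (G (v - x'))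
        + inner ℝ (u' + (y' - y)) (B (v - x'))) + t * (‖G (v - x')‖ ^ 2 / 2)) := by nlinarith
      exact nonneg_of_mul_nonneg_right h4 ht
    exact nonneg_of_forall_add_mul_nonneg key
  have h1 := hle (x' + d)
  have h2 := hle (x' - d)
  rw [add_sub_cancel_left] at h1
  rw [sub_sub_cancel_left, map_neg, map_neg, inner_neg_right, inner_neg_right] at h2
  linarith

theorem subgradient (hθ : ConvexOn ℝ Set.univ θ) (h : IsADMMStep B G c θ y u x' y' u') :
    IsSubgradient θ y' u' := by
  intro v
  have h1 := le_add_inner_of_isMin hθ (-LinearMap.id) (B x' + c + u) (x := y') (fun v => by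
    have := h.min_y v
    simp only [LinearMap.neg_apply, LinearMap.id_apply]
    convert this using 5 <;> abel) v
  have h2 : (-LinearMap.id : Y →ₗ[ℝ] Y) y' + (B x' + c + u) = u' := by
    rw [h.update, LinearMap.neg_apply, LinearMap.id_apply]; abel
  rw [h2, LinearMap.neg_apply, LinearMap.id_apply, inner_neg_right] at h1
  linarith

/-- The Fejér inequality. That `u` is a subgradient at `y` holds for every iterate but the
starting point. -/
theorem fejer (hθ : ConvexOn ℝ Set.univ θ) (h : IsADMMStep B G c θ y u x' y' u')
    (hyu : IsSubgradient θ y u) {xs : X} {us : Y} (hs : IsKKT B G c θ xs us) :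
    ‖y' - (B xs + c)‖ ^ 2 + ‖u' - us‖ ^ 2
      + (‖u' - u‖ ^ 2 + ‖y' - y‖ ^ 2 + 2 * ‖G (x' - xs)‖ ^ 2)
      ≤ ‖y - (B xs + c)‖ ^ 2 + ‖u - us‖ ^ 2 := by
  have h1 := h.stationary (x' - xs)
  have h2 := hs.stationary (x' - xs)
  have h3 := (h.subgradient hθ).monotone hs.subgradient
  have h4 := (h.subgradient hθ).monotone hyu
  set ys := B xs + c with hys
  have hB : B (x' - xs) = (u' - u) + (y' - ys) := by rw [h.update, hys, map_sub]; abel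
  have hG : inner ℝ (G x') (G (x' - xs)) - inner ℝ (G xs) (G (x' - xs)) = ‖G (x' - xs)‖ ^ 2 := by
    rw [← inner_sub_left, ← map_sub, real_inner_self_eq_norm_sq]
  rw [hB] at h1 h2
  have e1 : y - ys = (y' - ys) - (y' - y) := by abel
  have e2 : u - us = (u' - us) - (u' - u) := by abel
  rw [e1, e2, norm_sub_sq_real (y' - ys), norm_sub_sq_real (u' - us)]
  have h5 : inner ℝ (u' + (y' - y)) ((u' - u) + (y' - ys)) - inner ℝ us ((u' - u) + (y' - ys))
      = inner ℝ (u' - us) (u' - u) + inner ℝ (u' - us) (y' - ys)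
        + inner ℝ (u' - u) (y' - y) + inner ℝ (y' - ys) (y' - y) := by
    rw [← inner_sub_left, show u' + (y' - y) - us = (u' - us) + (y' - y) by abel, inner_add_left,
      inner_add_right, inner_add_right, real_inner_comm (u' - u) (y' - y),
      real_inner_comm (y' - ys) (y' - y)]
    ring
  linarith

end IsADMMStep

theorem IsKKT.add_half_norm_sq_le {xs : X} {us : Y} (hs : IsKKT B G c θ xs us) (x : X) (y : Y) :
    ‖G xs‖ ^ 2 / 2 + θ (B xs + c) ≤ ‖G x‖ ^ 2 / 2 + θ y + inner ℝ us (B x + c - y) := by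
  have h1 := hs.stationary (x - xs)
  have h2 := hs.subgradient y
  have h3 : G x = G xs + G (x - xs) := by rw [map_sub]; abel
  have h4 : y - (B xs + c) = B (x - xs) - (B x + c - y) := by rw [map_sub]; abel
  rw [h4, inner_sub_right] at h2
  rw [h3, norm_add_sq_real]
  nlinarith [sq_nonneg ‖G (x - xs)‖]

/-- A minimizer has a multiplier: the open epigraph of `θ` around `B x + c` is separated from
the graph of the linear functional that the optimality of `x` puts below it. -/
theorem exists_isKKT [CompleteSpace Y] (hθ : ConvexOn ℝ Set.univ θ) (hθc : Continuous θ) {xs : X}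
    (hmin : ∀ x, ‖G xs‖ ^ 2 / 2 + θ (B xs + c) ≤ ‖G x‖ ^ 2 / 2 + θ (B x + c)) :
    ∃ us, IsKKT B G c θ xs us := by
  set ys := B xs + c with hys
  set φ : X → ℝ := fun d => -inner ℝ (G xs) (G d) with hφ
  have hopt : ∀ d, φ d ≤ θ (ys + B d) - θ ys := by
    intro d
    have hconv : ConvexOn ℝ Set.univ fun x => θ (B x + c) :=
      ⟨convex_univ, fun x _ y _ a b ha hb hab => by
        have := hθ.2 (Set.mem_univ (B x + c)) (Set.mem_univ (B y + c)) ha hb hab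
        convert this using 2
        rw [map_add, map_smul, map_smul, smul_add, smul_add]
        nth_rewrite 1 [← one_smul ℝ c]
        rw [← hab, add_smul]
        abel⟩
    have := le_add_inner_of_isMin hconv G 0 (x := xs) (fun v => by
      simp only [add_zero]; linarith [hmin v]) (xs + d)
    rw [add_zero, add_sub_cancel_left, map_add] at this
    rw [show ys + B d = B xs + B d + c by rw [hys]; abel]
    simp only [hφ]
    linarith
  let S₁ : Set (Y × ℝ) := {p | p.1 ∈ Set.univ ∧ θ (ys + p.1) - θ ys < p.2}
  have hS₁o : IsOpen S₁ := by
    simp only [S₁, Set.mem_univ, true_and]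
    exact isOpen_lt (by fun_prop) (by fun_prop)
  have hS₁c : Convex ℝ S₁ := by
    refine ConvexOn.convex_strict_epigraph (𝕜 := ℝ) (f := fun d => θ (ys + d) - θ ys) ?_
    have := hθ.translate_right ys
    simp only [Set.preimage_univ] at this
    exact this.add_const (-θ ys)
  let Sm : Submodule ℝ (Y × ℝ) := LinearMap.range
    (B.prod (-((innerₛₗ ℝ (G xs)).comp G)))
  have hmem : ∀ d, (B d, φ d) ∈ Sm := fun d => ⟨d, rfl⟩
  have hdisj : Disjoint S₁ (Sm : Set (Y × ℝ)) := by
    rw [Set.disjoint_left]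
    rintro _ ⟨-, hp⟩ ⟨d, rfl⟩
    have h1 := hopt d
    have h2 : θ (ys + B d) - θ ys < φ d := hp
    linarith
  obtain ⟨F, s, hF1, hF2⟩ := geometric_hahn_banach_open hS₁c hS₁o Sm.convex hdisj
  have hs0 : s ≤ 0 := by simpa using hF2 0 Sm.zero_mem
  have hF0 : ∀ p ∈ Sm, F p = 0 := by
    intro p hp
    by_contra hne
    have := hF2 (((s - 1) / F p) • p) (Sm.smul_mem _ hp)
    rw [map_smul, smul_eq_mul, div_mul_cancel₀ _ hne] at this
    linarith
  have hsplit : ∀ d t, F (d, t) = F (d, 0) + t * F (0, 1) := by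
    intro d t
    rw [← smul_eq_mul, ← map_smul, ← map_add]
    simp
  set τ := F (0, 1) with hτ
  have hτ0 : τ < 0 := by
    have := hF1 (0, 1) ⟨trivial, by simp⟩
    linarith
  let us : Y := (InnerProductSpace.toDual ℝ Y).symm
    ((-τ)⁻¹ • F.comp (ContinuousLinearMap.inl ℝ Y ℝ))
  have hus : ∀ d, inner ℝ us d = (-τ)⁻¹ * F (d, 0) := by
    intro d
    rw [InnerProductSpace.toDual_symm_apply]
    simp
  have hτp : 0 < (-τ)⁻¹ := inv_pos.2 (neg_pos.2 hτ0)
  refine ⟨us, fun d => ?_, fun y' => ?_⟩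
  · have h1 := hF0 _ (hmem d)
    rw [hsplit] at h1
    have h2 : F (B d, 0) = (-τ) * φ d := by linarith
    rw [hus, h2, inv_mul_cancel_left₀ (neg_pos.2 hτ0).ne']
    simp [hφ]
  · rw [hus]
    have h1 : F (y' - ys, 0) ≤ (-τ) * (θ y' - θ ys) := by
      refine le_of_forall_pos_le_add fun ε hε => ?_
      have := hF1 (y' - ys, θ y' - θ ys + ε / (-τ)) ⟨trivial, by
        simp only [add_sub_cancel]
        have := div_pos hε (neg_pos.2 hτ0)
        linarith⟩
      rw [hsplit] at this
      have h2 : ε / (-τ) * τ = -ε := by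
        rw [div_neg, neg_mul, div_mul_cancel₀ _ hτ0.ne]
      rw [add_mul, h2] at this
      linarith
    have h2 := mul_le_mul_of_nonneg_left h1 hτp.le
    rw [inv_mul_cancel_left₀ (neg_pos.2 hτ0).ne'] at h2
    linarith

/-- Convergence of ADMM: the residual vanishes and the objective values tend to the minimum.
The iterate `x (k + 1)` of the usual indexing is `x k` here. -/
theorem tendsto_of_isADMMStep (hθ : ConvexOn ℝ Set.univ θ) {x : ℕ → X} {y u : ℕ → Y}
    (h : ∀ k, IsADMMStep B G c θ (y k) (u k) (x k) (y (k + 1)) (u (k + 1)))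
    {xs : X} {us : Y} (hs : IsKKT B G c θ xs us) :
    Tendsto (fun k => ‖B (x k) + c - y (k + 1)‖) atTop (𝓝 0) ∧
    Tendsto (fun k => ‖G (x k)‖ ^ 2 / 2 + θ (y (k + 1))) atTop
      (𝓝 (‖G xs‖ ^ 2 / 2 + θ (B xs + c))) := by
  have hsub : ∀ k, IsSubgradient θ (y (k + 1)) (u (k + 1)) := fun k => (h k).subgradient hθ
  set ys := B xs + c with hys
  set V : ℕ → ℝ := fun k => ‖y (k + 1) - ys‖ ^ 2 + ‖u (k + 1) - us‖ ^ 2 with hV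
  set r : ℕ → Y := fun k => u (k + 2) - u (k + 1) with hr
  set s : ℕ → Y := fun k => y (k + 2) - y (k + 1) with hsd
  have hfej : ∀ k, V (k + 1) + (‖r k‖ ^ 2 + ‖s k‖ ^ 2) ≤ V k := by
    intro k
    have := (h (k + 1)).fejer hθ (hsub k) hs
    have h0 := sq_nonneg ‖G (x (k + 1) - xs)‖
    simp only [hV, hr, hsd]
    linarith
  have hV0 : ∀ k, 0 ≤ V k := fun k => by positivity
  have hanti : Antitone V := antitone_nat_of_succ_le fun k => by
    have := hfej k
    have := sq_nonneg ‖r k‖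
    have := sq_nonneg ‖s k‖
    linarith
  have hVlim : Tendsto V atTop (𝓝 (⨅ k, V k)) :=
    tendsto_atTop_ciInf hanti ⟨0, by rintro _ ⟨k, rfl⟩; exact hV0 k⟩
  have hdiff : Tendsto (fun k => V k - V (k + 1)) atTop (𝓝 0) := by
    simpa using hVlim.sub (hVlim.comp (tendsto_add_atTop_nat 1))
  have sq0 : ∀ w : ℕ → Y, (∀ k, ‖w k‖ ^ 2 ≤ V k - V (k + 1)) →
      Tendsto (fun k => ‖w k‖) atTop (𝓝 0) := by
    intro w hw
    have h1 := squeeze_zero (fun k => sq_nonneg ‖w k‖) hw hdiff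
    have h2 := h1.sqrt
    simpa [Real.sqrt_sq (norm_nonneg _)] using h2
  have hr0 : Tendsto (fun k => ‖r k‖) atTop (𝓝 0) :=
    sq0 r fun k => by linarith [hfej k, sq_nonneg ‖s k‖]
  have hs0 : Tendsto (fun k => ‖s k‖) atTop (𝓝 0) :=
    sq0 s fun k => by linarith [hfej k, sq_nonneg ‖r k‖]
  have hres : ∀ k, B (x (k + 1)) + c - y (k + 2) = r k := fun k => by
    rw [hr]
    simp only
    rw [(h (k + 1)).update]
    abel
  refine ⟨(tendsto_add_atTop_iff_nat 1).1 (by simpa only [hres] using hr0), ?_⟩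
  refine (tendsto_add_atTop_iff_nat 1).1 ?_
  -- Both bounds differ from the minimum by inner products of a bounded and a vanishing sequence.
  set p := ‖G xs‖ ^ 2 / 2 + θ ys with hp
  have hVk : ∀ k, V k ≤ V 0 := fun k => hanti (Nat.zero_le k)
  have hub : ∀ k, ‖u (k + 1)‖ ≤ √(V 0) + ‖us‖ := by
    intro k
    have h1 : ‖u (k + 1) - us‖ ≤ √(V 0) := by
      refine Real.le_sqrt_of_sq_le ?_
      have := hVk k
      have h3 := sq_nonneg ‖y (k + 1) - ys‖
      simp only [hV] at this ⊢
      linarith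
    have := norm_sub_norm_le (u (k + 1)) us
    linarith
  have hyb : ∀ k, ‖y (k + 1) - ys‖ ≤ √(V 0) := by
    intro k
    refine Real.le_sqrt_of_sq_le ?_
    have := hVk k
    have h3 := sq_nonneg ‖u (k + 1) - us‖
    simp only [hV] at this ⊢
    linarith
  have hlow : ∀ k, p - ‖us‖ * ‖r k‖ ≤ ‖G (x (k + 1))‖ ^ 2 / 2 + θ (y (k + 2)) := by
    intro k
    have h1 := hs.add_half_norm_sq_le (x (k + 1)) (y (k + 2))
    rw [hres] at h1
    have h2 := real_inner_le_norm us (r k)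
    linarith
  have hupp : ∀ k, ‖G (x (k + 1))‖ ^ 2 / 2 + θ (y (k + 2)) ≤
      p + ((√(V 0) + ‖us‖) * ‖r k‖ + ‖s k‖ * (‖r k‖ + √(V 0))) := by
    intro k
    have h1 := (h (k + 1)).stationary (x (k + 1) - xs)
    have h2 := hsub (k + 1) ys
    have hB : B (x (k + 1) - xs) = r k + (y (k + 2) - ys) := by
      rw [← hres, hys, map_sub]; abel
    have hG : G xs = G (x (k + 1)) - G (x (k + 1) - xs) := by rw [map_sub]; abel
    have h3 := norm_sub_sq_real (G (x (k + 1))) (G (x (k + 1) - xs))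
    rw [← hG] at h3
    rw [show y (k + 1 + 1) - y (k + 1) = s k from rfl, inner_add_left, hB] at h1
    rw [← neg_sub (y (k + 1 + 1)) ys, inner_neg_right] at h2
    rw [inner_add_right (u (k + 1 + 1))] at h1
    have h4 : -inner ℝ (u (k + 1 + 1)) (r k) ≤ (√(V 0) + ‖us‖) * ‖r k‖ := by
      rw [← inner_neg_left]
      refine (real_inner_le_norm _ _).trans ?_
      rw [norm_neg]
      exact mul_le_mul_of_nonneg_right (hub (k + 1)) (norm_nonneg _)
    have h5 : -inner ℝ (s k) (r k + (y (k + 2) - ys)) ≤ ‖s k‖ * (‖r k‖ + √(V 0)) := by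
      rw [← inner_neg_left]
      refine (real_inner_le_norm _ _).trans ?_
      rw [norm_neg]
      exact mul_le_mul_of_nonneg_left
        ((norm_add_le _ _).trans (add_le_add le_rfl (hyb (k + 1)))) (norm_nonneg _)
    have h6 := sq_nonneg ‖G (x (k + 1) - xs)‖
    simp only [hp]
    linarith
  refine tendsto_of_tendsto_of_tendsto_of_le_of_le ?_ ?_ hlow hupp
  · simpa using tendsto_const_nhds.sub (hr0.const_mul ‖us‖)
  · simpa using tendsto_const_nhds.add
      ((hr0.const_mul (√(V 0) + ‖us‖)).add (hs0.mul (hr0.add_const (√(V 0)))))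

end ADMM

/-! ### Linear convergence for polyhedral functions -/

section Linear

variable {ι : Type*} [Fintype ι]

/-- Subgradients of a separable function are computed coordinatewise. -/
theorem isSubgradient_sum_iff {φ : ι → ℝ → ℝ} {y u : EuclideanSpace ℝ ι} :
    IsSubgradient (fun y : EuclideanSpace ℝ ι => ∑ i, φ i (y i)) y u ↔
      ∀ i s, φ i (y i) + u i * (s - y i) ≤ φ i s := by
  classical
  have hin : ∀ y' : EuclideanSpace ℝ ι, inner ℝ u (y' - y) = ∑ i, u i * (y' i - y i) := by
    intro y'
    simp [PiLp.inner_apply, mul_comm]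
  constructor
  · intro h i s
    have h1 := h (WithLp.toLp 2 (Function.update y.ofLp i s))
    simp only at h1
    rw [hin, ← Finset.sum_add_distrib, ← Finset.sum_erase_add _ _ (Finset.mem_univ i),
      ← Finset.sum_erase_add (a := i) (s := Finset.univ) _ (Finset.mem_univ i)] at h1
    have h2 : ∀ j ∈ Finset.univ.erase i, φ j (y j) + u j *
        ((WithLp.toLp 2 (Function.update y.ofLp i s) : EuclideanSpace ℝ ι) j - y j)
        = φ j ((WithLp.toLp 2 (Function.update y.ofLp i s) : EuclideanSpace ℝ ι) j) := by
      intro j hj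
      simp [Finset.ne_of_mem_erase hj]
    rw [Finset.sum_congr rfl h2] at h1
    simp at h1
    linarith
  · intro h y'
    simp only
    rw [hin, ← Finset.sum_add_distrib]
    exact Finset.sum_le_sum fun i _ => h i _

/-- Near `t₀` the subdifferential of a polyhedral function on the line is contained in its
subdifferential at `t₀`. -/
theorem eventually_subgradient_max_mul {l h : ℝ} (t₀ : ℝ) : ∀ᶠ t in 𝓝 t₀, ∀ v : ℝ,
    (∀ s, max (l * t) (h * t) + v * (s - t) ≤ max (l * s) (h * s)) →
      ∀ s, max (l * t₀) (h * t₀) + v * (s - t₀) ≤ max (l * s) (h * s) := by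
  have hscale : ∀ r, 0 < r → ∀ s, max (l * (r * s)) (h * (r * s)) = r * max (l * s) (h * s) := by
    intro r hr s
    rw [mul_max_of_nonneg _ _ hr.le]
    ring_nf
  have hsame : ∀ t, 0 < t₀ / t → ∀ v : ℝ,
      (∀ s, max (l * t) (h * t) + v * (s - t) ≤ max (l * s) (h * s)) →
        ∀ s, max (l * t₀) (h * t₀) + v * (s - t₀) ≤ max (l * s) (h * s) := by
    intro t hr v hv s
    have ht : t ≠ 0 := by rintro rfl; simp at hr
    have e1 : t₀ = t₀ / t * t := by field_simp
    have e2 : s = t₀ / t * (s / (t₀ / t)) := (mul_div_cancel₀ s hr.ne').symm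
    generalize t₀ / t = r at *
    have h1 := mul_le_mul_of_nonneg_left (hv (s / r)) hr.le
    rw [mul_add, ← hscale r hr, ← hscale r hr, ← e1, ← e2] at h1
    have h2 : r * (v * (s / r - t)) = v * (s - t₀) := by
      rw [e1]; field_simp
    rwa [h2] at h1
  rcases lt_trichotomy t₀ 0 with h0 | rfl | h0
  · filter_upwards [eventually_lt_nhds h0] with t ht using hsame t (div_pos_of_neg_of_neg h0 ht)
  · refine Eventually.of_forall fun t v hv s => ?_
    have h1 := hv (t + s)
    have h2 : max (l * (t + s)) (h * (t + s))
        ≤ max (l * t) (h * t) + max (l * s) (h * s) := by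
      rw [mul_add, mul_add]
      exact max_add_add_le_max_add_max
    rw [add_sub_cancel_left] at h1
    simp only [mul_zero, max_self, sub_zero, zero_add]
    linarith
  · filter_upwards [eventually_gt_nhds h0] with t ht using hsame t (div_pos h0 ht)

/-- A Hoffman error bound: a point that nearly satisfies the linear equations
`⟪u' - u₀, s⟫ = 0`, `s ∈ S`, can be moved to a solution in the box spanned by it and `u₀`, by a
distance proportional to the error. -/
theorem exists_hoffman_bound (S : Submodule ℝ (EuclideanSpace ℝ ι)) :
    ∃ κ : ℝ, 0 ≤ κ ∧ ∀ (u u₀ : EuclideanSpace ℝ ι) (ε : ℝ), 0 ≤ ε →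
      (∀ s ∈ S, |inner ℝ (u - u₀) s| ≤ ε * ‖s‖) →
      ∃ u' : EuclideanSpace ℝ ι, (∀ i, u' i ∈ Set.uIcc (u i) (u₀ i)) ∧
        (∀ s ∈ S, inner ℝ (u' - u₀) s = 0) ∧ ‖u - u'‖ ≤ κ * ε := by
  set e : (ι → ℝ) →ₗ[ℝ] EuclideanSpace ℝ ι :=
    (WithLp.linearEquiv 2 ℝ (ι → ℝ)).symm.toLinearMap with he
  have hei : ∀ w i, (e w) i = w i := fun w i => rfl
  set A : (ι → ℝ) →ₗ[ℝ] S := S.orthogonalProjectionOnto.toLinearMap ∘ₗ e with hA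
  obtain ⟨κ, hκ0, hκ⟩ := exists_conformal_preimage A
  set ec := LinearMap.toContinuousLinearMap e with hec
  refine ⟨‖ec‖ * κ, by positivity, fun u u₀ ε hε h => ?_⟩
  obtain ⟨c, hc, hAc, hcn⟩ := hκ (u₀ - u).ofLp
  have hw : e (u₀ - u).ofLp = u₀ - u := rfl
  have hin : ∀ v, ∀ s ∈ S, inner ℝ (e v) s = inner ℝ ((A v : S) : EuclideanSpace ℝ ι) s := by
    intro v s hs
    exact (S.inner_orthogonalProjectionOnto_eq_of_mem_right ⟨s, hs⟩ (e v)).symm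
  have hAw : ‖A (u₀ - u).ofLp‖ ≤ ε := by
    have h1 := h _ (A (u₀ - u).ofLp).2
    rw [← neg_sub u₀ u, inner_neg_left, abs_neg,
      show inner ℝ (u₀ - u) _ = _ from hin (u₀ - u).ofLp _ (A (u₀ - u).ofLp).2,
      real_inner_self_eq_norm_sq, abs_of_nonneg (sq_nonneg _), ← Submodule.coe_norm, sq] at h1
    by_contra hlt
    push Not at hlt
    have hp : 0 < ‖A (u₀ - u).ofLp‖ := hε.trans_lt hlt
    exact hlt.not_ge (le_of_mul_le_mul_right h1 hp)
  refine ⟨u + e c, fun i => ?_, fun s hs => ?_, ?_⟩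
  · have h1 := hc i
    rw [Set.mem_uIcc] at h1 ⊢
    simp only [PiLp.add_apply, hei, PiLp.sub_apply] at h1 ⊢
    rcases h1 with h1 | h1
    · exact Or.inl ⟨by linarith, by linarith⟩
    · exact Or.inr ⟨by linarith, by linarith⟩
  · have h1 : u + e c - u₀ = e c - e (u₀ - u).ofLp := by rw [hw]; abel
    rw [h1, inner_sub_left, hin _ _ hs, hin _ _ hs, hAc, sub_self]
  · rw [sub_add_cancel_left, norm_neg]
    calc ‖e c‖ = ‖ec c‖ := rfl
      _ ≤ ‖ec‖ * ‖c‖ := ec.le_opNorm c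
      _ ≤ ‖ec‖ * (κ * ‖A (u₀ - u).ofLp‖) := by gcongr
      _ ≤ ‖ec‖ * κ * ε := by rw [mul_assoc]; gcongr

theorem exists_tendsto_of_geometric {E : Type*} [NormedAddCommGroup E] [CompleteSpace E]
    {f : ℕ → E} {C ρ : ℝ} (hρ : ρ < 1) (h : ∀ k, ‖f (k + 1) - f k‖ ≤ C * ρ ^ k) :
    ∃ a, ∀ k, ‖f k - a‖ ≤ C / (1 - ρ) * ρ ^ k := by
  have h' : ∀ k, dist (f k) (f (k + 1)) ≤ C * ρ ^ k := fun k => by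
    rw [dist_comm, dist_eq_norm]; exact h k
  obtain ⟨a, ha⟩ := cauchySeq_tendsto_of_complete (cauchySeq_of_le_geometric ρ C hρ h')
  refine ⟨a, fun k => ?_⟩
  rw [← dist_eq_norm]
  refine (dist_le_of_le_geometric_of_tendsto ρ C hρ h' ha k).trans (le_of_eq ?_)
  ring

variable {X Z : Type*} [AddCommGroup X] [Module ℝ X]
  [NormedAddCommGroup Z] [InnerProductSpace ℝ Z]
  {B : X →ₗ[ℝ] EuclideanSpace ℝ ι} {G : X →ₗ[ℝ] Z} {c : EuclideanSpace ℝ ι}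

theorem convexOn_sum_max_mul (l h : ι → ℝ) : ConvexOn ℝ Set.univ
    fun y : EuclideanSpace ℝ ι => ∑ i, max (l i * y i) (h i * y i) := by
  refine ⟨convex_univ, fun x _ y _ a b ha hb _ => ?_⟩
  simp only [PiLp.add_apply, PiLp.smul_apply, smul_eq_mul, Finset.mul_sum]
  rw [← Finset.sum_add_distrib]
  refine Finset.sum_le_sum fun i _ => ?_
  rw [mul_max_of_nonneg _ _ ha, mul_max_of_nonneg _ _ hb]
  refine le_trans (le_of_eq ?_) max_add_add_le_max_add_max
  ring_nf

/-- Linear convergence of ADMM when the smooth part is strongly convex and the other part is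
polyhedral. The value `B x` at a solution is unique, the multiplier need not be: what contracts
involves the distance to the set of multipliers, by the Fejér inequality and the Hoffman bound.
The bounds `hBG` and `hGB` express that `G` and `B` control each other. -/
theorem exists_linear_rate (l h : ι → ℝ) {K₁ K₂ : ℝ}
    (hBG : ∀ d, ‖B d‖ ≤ K₁ * ‖G d‖) (hGB : ∀ d, ‖G d‖ ≤ K₂ * ‖B d‖)
    {x : ℕ → X} {y u : ℕ → EuclideanSpace ℝ ι}
    (hstep : ∀ k, IsADMMStep B G c (fun y => ∑ i, max (l i * y i) (h i * y i))
      (y k) (u k) (x k) (y (k + 1)) (u (k + 1)))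
    {xs : X} {us : EuclideanSpace ℝ ι}
    (hs : IsKKT B G c (fun y => ∑ i, max (l i * y i) (h i * y i)) xs us) :
    ∃ (ul : EuclideanSpace ℝ ι) (C ρ : ℝ) (N : ℕ), 0 < ρ ∧ ρ < 1 ∧ ∀ m,
      ‖G (x (N + m) - xs)‖ ≤ C * ρ ^ m ∧ ‖y (N + m + 1) - (B xs + c)‖ ≤ C * ρ ^ m ∧
      ‖u (N + m + 1) - ul‖ ≤ C * ρ ^ m := by
  set θ : EuclideanSpace ℝ ι → ℝ := fun y => ∑ i, max (l i * y i) (h i * y i) with hθdef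
  have hθ : ConvexOn ℝ Set.univ θ := convexOn_sum_max_mul l h
  have hiff : ∀ y u, IsSubgradient θ y u ↔
      ∀ i s, max (l i * y i) (h i * y i) + u i * (s - y i) ≤ max (l i * s) (h i * s) :=
    fun _ _ => isSubgradient_sum_iff (φ := fun i s => max (l i * s) (h i * s))
  set ys := B xs + c with hys
  have hsub : ∀ k, IsSubgradient θ (y (k + 1)) (u (k + 1)) := fun k => (hstep k).subgradient hθ
  -- Replace `K₁`, `K₂` by nonnegative constants.
  have hBG' : ∀ d, ‖B d‖ ≤ |K₁| * ‖G d‖ := fun d =>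
    (hBG d).trans (mul_le_mul_of_nonneg_right (le_abs_self _) (norm_nonneg _))
  have hGB' : ∀ d, ‖G d‖ ≤ |K₂| * ‖B d‖ := fun d =>
    (hGB d).trans (mul_le_mul_of_nonneg_right (le_abs_self _) (norm_nonneg _))
  set M : Set (EuclideanSpace ℝ ι) := {v | IsKKT B G c θ xs v} with hM
  have hMne : M.Nonempty := ⟨us, hs⟩
  have hMc : IsClosed M := by
    have : M = {v | ∀ d, inner ℝ (G xs) (G d) + inner ℝ v (B d) = 0} ∩
        {v | ∀ y', θ ys + inner ℝ v (y' - ys) ≤ θ y'} := by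
      ext v
      exact ⟨fun h => ⟨h.stationary, h.subgradient⟩, fun h => ⟨h.1, h.2⟩⟩
    rw [this]
    refine IsClosed.inter ?_ ?_
    · simp only [Set.ofPred_forall]
      exact isClosed_iInter fun d => isClosed_eq (by fun_prop) continuous_const
    · simp only [Set.ofPred_forall]
      exact isClosed_iInter fun d => isClosed_le (by fun_prop) continuous_const
  set Q : ℕ → ℝ := fun k => ‖u (k + 2) - u (k + 1)‖ ^ 2 + ‖y (k + 2) - y (k + 1)‖ ^ 2
    + 2 * ‖G (x (k + 1) - xs)‖ ^ 2 with hQ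
  -- The contracting quantity; it decreases by at least `Q`.
  set E : ℕ → ℝ := fun k => ‖y (k + 1) - ys‖ ^ 2 + Metric.infDist (u (k + 1)) M ^ 2 with hE
  have hE0 : ∀ k, 0 ≤ E k := fun k => by positivity
  have hEQ : ∀ k, E (k + 1) + Q k ≤ E k := by
    intro k
    obtain ⟨v, hv, hd⟩ := hMc.exists_infDist_eq_dist hMne (u (k + 1))
    have h1 := (hstep (k + 1)).fejer hθ (hsub k) hv
    have h2 : Metric.infDist (u (k + 2)) M ^ 2 ≤ ‖u (k + 2) - v‖ ^ 2 := by
      rw [← dist_eq_norm]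
      exact pow_le_pow_left₀ Metric.infDist_nonneg (Metric.infDist_le_dist_of_mem hv) 2
    simp only [hE, hQ, hd, dist_eq_norm]
    linarith
  have hB : ∀ k, y (k + 2) - ys = B (x (k + 1) - xs) - (u (k + 2) - u (k + 1)) := by
    intro k
    rw [show u (k + 2) = _ from (hstep (k + 1)).update, map_sub, hys]
    abel
  have hroots : ∀ k, ‖G (x (k + 1) - xs)‖ ≤ √(Q k) ∧ ‖u (k + 2) - u (k + 1)‖ ≤ √(Q k) ∧
      ‖y (k + 2) - y (k + 1)‖ ≤ √(Q k) := by
    intro k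
    have e1 := sq_nonneg ‖u (k + 2) - u (k + 1)‖
    have e2 := sq_nonneg ‖y (k + 2) - y (k + 1)‖
    have e3 := sq_nonneg ‖G (x (k + 1) - xs)‖
    refine ⟨Real.le_sqrt_of_sq_le ?_, Real.le_sqrt_of_sq_le ?_, Real.le_sqrt_of_sq_le ?_⟩ <;>
      simp only [hQ] <;> linarith
  have hylim : Tendsto y atTop (𝓝 ys) := by
    have hEanti : Antitone E := antitone_nat_of_succ_le fun k => by
      have := hEQ k
      have : 0 ≤ Q k := by positivity
      linarith
    have hElim : Tendsto E atTop (𝓝 (⨅ k, E k)) :=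
      tendsto_atTop_ciInf hEanti ⟨0, by rintro _ ⟨k, rfl⟩; exact hE0 k⟩
    have hQ0 : Tendsto Q atTop (𝓝 0) := by
      refine squeeze_zero (fun k => by positivity) (fun k => ?_)
        (by simpa using hElim.sub (hElim.comp (tendsto_add_atTop_nat 1)))
      linarith [hEQ k]
    have hsq : Tendsto (fun k => √(Q k)) atTop (𝓝 0) := by simpa using hQ0.sqrt
    refine (tendsto_add_atTop_iff_nat 2).1 (tendsto_iff_norm_sub_tendsto_zero.2 ?_)
    refine squeeze_zero (fun k => norm_nonneg _) (fun k => ?_)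
      (by simpa using hsq.const_mul (|K₁| + 1))
    obtain ⟨h1, h2, -⟩ := hroots k
    rw [hB]
    calc _ ≤ ‖B (x (k + 1) - xs)‖ + ‖u (k + 2) - u (k + 1)‖ := norm_sub_le _ _
      _ ≤ |K₁| * √(Q k) + √(Q k) := by
        refine add_le_add ((hBG' _).trans ?_) h2
        gcongr
      _ = (|K₁| + 1) * √(Q k) := by ring
  -- From some index on, the multipliers are subgradients at the solution itself.
  have hev : ∀ᶠ k in atTop, IsSubgradient θ ys (u (k + 1)) := by
    have h1 : ∀ᶠ k in atTop, ∀ i, ∀ v : ℝ,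
        (∀ s, max (l i * y (k + 1) i) (h i * y (k + 1) i) + v * (s - y (k + 1) i)
          ≤ max (l i * s) (h i * s)) →
        ∀ s, max (l i * ys i) (h i * ys i) + v * (s - ys i) ≤ max (l i * s) (h i * s) := by
      refine eventually_all.2 fun i => ?_
      have h2 : Tendsto (fun k => y (k + 1) i) atTop (𝓝 (ys i)) :=
        (((EuclideanSpace.proj i : EuclideanSpace ℝ ι →L[ℝ] ℝ).continuous.tendsto ys).comp
          hylim).comp (tendsto_add_atTop_nat 1)
      exact h2.eventually (eventually_subgradient_max_mul (ys i))
    filter_upwards [h1] with k hk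
    refine (hiff _ _).2 fun i s => ?_
    exact hk i _ ((hiff _ _).1 (hsub k) i) s
  obtain ⟨N, hN⟩ := eventually_atTop.1 hev
  obtain ⟨κ, hκ0, hκ⟩ := exists_hoffman_bound (LinearMap.range B)
  set K : ℝ := (|K₁| + 1) ^ 2 + (κ * (1 + |K₂|)) ^ 2 with hK
  have hK0 : 0 < K := by positivity
  have hEK : ∀ k, N ≤ k + 1 → E (k + 1) ≤ K * Q k := by
    intro k hk
    set q := √(Q k) with hq
    have hqq : q ^ 2 = Q k := Real.sq_sqrt (by positivity)
    obtain ⟨h1, h2, h3⟩ := hroots k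
    have hq0 : 0 ≤ q := Real.sqrt_nonneg _
    have h4 : ‖y (k + 2) - ys‖ ≤ (|K₁| + 1) * q := by
      rw [hB]
      calc _ ≤ ‖B (x (k + 1) - xs)‖ + ‖u (k + 2) - u (k + 1)‖ := norm_sub_le _ _
        _ ≤ |K₁| * q + q := by
          refine add_le_add ((hBG' _).trans ?_) h2
          gcongr
        _ = (|K₁| + 1) * q := by ring
    have h5 : Metric.infDist (u (k + 2)) M ≤ κ * (1 + |K₂|) * q := by
      obtain ⟨v, hv1, hv2, hv3⟩ := hκ (u (k + 2)) us ((1 + |K₂|) * q) (by positivity) (by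
        rintro _ ⟨d, rfl⟩
        have e1 := (hstep (k + 1)).stationary d
        have e2 := hs.stationary d
        rw [inner_add_left] at e1
        have e3 : inner ℝ (u (k + 2) - us) (B d) = -(inner ℝ (y (k + 2) - y (k + 1)) (B d)
            + inner ℝ (G (x (k + 1) - xs)) (G d)) := by
          rw [inner_sub_left, map_sub, inner_sub_left (G _)]
          rw [show k + 1 + 1 = k + 2 from rfl] at e1
          linarith
        rw [e3, abs_neg]
        calc _ ≤ |inner ℝ (y (k + 2) - y (k + 1)) (B d)|
              + |inner ℝ (G (x (k + 1) - xs)) (G d)| := abs_add_le _ _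
          _ ≤ ‖y (k + 2) - y (k + 1)‖ * ‖B d‖ + ‖G (x (k + 1) - xs)‖ * ‖G d‖ :=
            add_le_add (abs_real_inner_le_norm _ _) (abs_real_inner_le_norm _ _)
          _ ≤ q * ‖B d‖ + q * (|K₂| * ‖B d‖) := by
            gcongr
            exact hGB' d
          _ = (1 + |K₂|) * q * ‖B d‖ := by ring)
      have hvM : v ∈ M := by
        refine ⟨fun d => ?_, ?_⟩
        · have e1 := hv2 (B d) ⟨d, rfl⟩
          rw [inner_sub_left] at e1
          linarith [hs.stationary d]
        · refine (hiff _ _).2 fun i s => ?_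
          -- The subgradient inequality at `ys` is affine in the multiplier.
          have e1 := (hiff _ _).1 (hN (k + 1) hk) i s
          have e2 := (hiff _ _).1 hs.subgradient i s
          have e3 := hv1 i
          rw [← segment_eq_uIcc] at e3
          obtain ⟨a, b, ha, hb, hab, e4⟩ := e3
          simp only [smul_eq_mul] at e4
          have e5 := mul_le_mul_of_nonneg_left e1 ha
          have e6 := mul_le_mul_of_nonneg_left e2 hb
          have hb' : b = 1 - a := by linarith
          subst hb'
          rw [← e4]
          linarith
      calc _ ≤ dist (u (k + 2)) v := Metric.infDist_le_dist_of_mem hvM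
        _ ≤ κ * ((1 + |K₂|) * q) := by rw [dist_eq_norm]; exact hv3
        _ = κ * (1 + |K₂|) * q := by ring
    calc E (k + 1) ≤ ((|K₁| + 1) * q) ^ 2 + (κ * (1 + |K₂|) * q) ^ 2 :=
          add_le_add (pow_le_pow_left₀ (norm_nonneg _) h4 2)
            (pow_le_pow_left₀ Metric.infDist_nonneg h5 2)
      _ = K * Q k := by rw [← hqq, hK]; ring
  set ρ : ℝ := √(K / (K + 1)) with hρdef
  have hρ0 : 0 < ρ := Real.sqrt_pos.2 (by positivity)
  have hρsq : ρ ^ 2 = K / (K + 1) := Real.sq_sqrt (by positivity)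
  have hρ1 : ρ < 1 := by
    rw [hρdef, Real.sqrt_lt' one_pos, one_pow, div_lt_one (by positivity)]
    linarith
  have hEdecay : ∀ m, E (N + m) ≤ E N * (ρ ^ m) ^ 2 := by
    intro m
    induction m with
    | zero => simp
    | succ m ih =>
      have h1 := hEQ (N + m)
      have h2 := hEK (N + m) (by omega)
      have h3 : E (N + m + 1) ≤ ρ ^ 2 * E (N + m) := by
        rw [hρsq, div_mul_eq_mul_div, le_div_iff₀ (by positivity)]
        nlinarith
      calc E (N + (m + 1)) ≤ ρ ^ 2 * E (N + m) := h3
        _ ≤ ρ ^ 2 * (E N * (ρ ^ m) ^ 2) := by gcongr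
        _ = E N * (ρ ^ (m + 1)) ^ 2 := by ring
  set C : ℝ := √(E N) with hC
  have hC0 : 0 ≤ C := Real.sqrt_nonneg _
  have hCsq : C ^ 2 = E N := Real.sq_sqrt (hE0 N)
  have hroot : ∀ (t : ℝ) m, t ^ 2 ≤ E (N + m) → t ≤ C * ρ ^ m := by
    intro t m ht
    refine le_of_sq_le_sq (ht.trans ((hEdecay m).trans (le_of_eq ?_))) (by positivity)
    rw [mul_pow, hCsq]
  have hQE : ∀ m, Q (N + m) ≤ E (N + m) := fun m => by linarith [hEQ (N + m), hE0 (N + m + 1)]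
  obtain ⟨ul, hul⟩ := exists_tendsto_of_geometric (f := fun m => u (N + 1 + m + 1)) hρ1
    (C := C * ρ) (fun m => by
      rw [mul_assoc, ← pow_succ']
      refine hroot _ _ (le_trans ?_ (hQE (m + 1)))
      simp only [hQ]
      rw [show N + 1 + (m + 1) + 1 = N + (m + 1) + 2 by ring,
        show N + 1 + m + 1 = N + (m + 1) + 1 by ring]
      nlinarith [sq_nonneg ‖y (N + (m + 1) + 2) - y (N + (m + 1) + 1)‖,
        sq_nonneg ‖G (x (N + (m + 1) + 1) - xs)‖])
  have hC' : 0 ≤ C * ρ / (1 - ρ) := div_nonneg (by positivity) (by linarith)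
  refine ⟨ul, C + C * ρ / (1 - ρ), ρ, N + 1, hρ0, hρ1, fun m => ⟨?_, ?_, ?_⟩⟩
  · refine (hroot _ m (le_trans ?_ (hQE m))).trans ?_
    · simp only [hQ]
      rw [show N + 1 + m = N + m + 1 by ring]
      nlinarith [sq_nonneg ‖y (N + m + 2) - y (N + m + 1)‖,
        sq_nonneg ‖u (N + m + 2) - u (N + m + 1)‖, sq_nonneg ‖G (x (N + m + 1) - xs)‖]
    · have : 0 ≤ ρ ^ m := by positivity
      nlinarith
  · have h1 : ‖y (N + 1 + m + 1) - ys‖ ≤ C * ρ ^ m := by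
      refine hroot _ m (le_trans ?_ (show E (N + m + 1) ≤ E (N + m) from ?_))
      · simp only [hE]
        rw [show N + 1 + m + 1 = N + m + 1 + 1 by ring]
        linarith [sq_nonneg (Metric.infDist (u (N + m + 1 + 1)) M)]
      · have : 0 ≤ Q (N + m) := by positivity
        linarith [hEQ (N + m)]
    have : 0 ≤ ρ ^ m := by positivity
    nlinarith
  · have := hul m
    have : 0 ≤ ρ ^ m := by positivity
    nlinarith

end Linear

/-! ### The models as two-block problems -/

section Norms

variable {m l : ℕ}

theorem frobInner_eq_sum (M N : Matrix (Fin m) (Fin l) ℝ) :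
    frobInner M N = ∑ i, ∑ j, M i j * N i j := by
  simp only [frobInner, Matrix.trace, Matrix.diag, Matrix.mul_apply, Matrix.transpose_apply]
  exact Finset.sum_comm

theorem frobInner_comm (M N : Matrix (Fin m) (Fin l) ℝ) : frobInner M N = frobInner N M := by
  simp only [frobInner_eq_sum, mul_comm]

theorem norm_sq_eq_sum (M : Matrix (Fin m) (Fin l) ℝ) : ‖M‖ ^ 2 = ∑ i, ∑ j, M i j ^ 2 := by
  rw [Matrix.frobenius_norm_def, ← Real.sqrt_eq_rpow, Real.sq_sqrt (by positivity)]
  simp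

theorem frobInner_self (M : Matrix (Fin m) (Fin l) ℝ) : frobInner M M = ‖M‖ ^ 2 := by
  rw [frobInner_eq_sum, norm_sq_eq_sum]
  simp only [sq]

theorem l2Norm_sq (b : Fin m → ℝ) : l2Norm b ^ 2 = ∑ i, b i ^ 2 := by
  simp [l2Norm, EuclideanSpace.real_norm_sq_eq]

theorem l2Norm_nonneg (b : Fin m → ℝ) : 0 ≤ l2Norm b := norm_nonneg _

theorem l1Norm_nonneg (M : Matrix (Fin m) (Fin l) ℝ) : 0 ≤ l1Norm M :=
  Finset.sum_nonneg fun _ _ => Finset.sum_nonneg fun _ _ => abs_nonneg _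

theorem rowNormSum_nonneg (q : ℝ≥0∞) [Fact (1 ≤ q)] (M : Matrix (Fin m) (Fin l) ℝ) :
    0 ≤ rowNormSum q M :=
  Finset.sum_nonneg fun _ _ => norm_nonneg _

theorem abs_entry_le_l1Norm (M : Matrix (Fin m) (Fin l) ℝ) (i : Fin m) (j : Fin l) :
    |M i j| ≤ l1Norm M :=
  (Finset.single_le_sum (f := fun j => |M i j|) (fun _ _ => abs_nonneg _)
    (Finset.mem_univ j)).trans
    (Finset.single_le_sum (f := fun i => ∑ j, |M i j|)
      (fun _ _ => Finset.sum_nonneg fun _ _ => abs_nonneg _) (Finset.mem_univ i))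

theorem norm_le_l1Norm (M : Matrix (Fin m) (Fin l) ℝ) : ‖M‖ ≤ l1Norm M := by
  refine le_of_sq_le_sq ?_ (l1Norm_nonneg M)
  rw [norm_sq_eq_sum, sq (l1Norm M)]
  nth_rewrite 1 [l1Norm]
  simp only [Finset.sum_mul]
  refine Finset.sum_le_sum fun i _ => Finset.sum_le_sum fun j _ => ?_
  rw [← sq_abs, sq]
  exact mul_le_mul_of_nonneg_left (abs_entry_le_l1Norm M i j) (abs_nonneg _)

theorem l1Norm_le_rowNormSum (q : ℝ≥0∞) [Fact (1 ≤ q)] (M : Matrix (Fin m) (Fin l) ℝ) :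
    l1Norm M ≤ l * rowNormSum q M := by
  rw [l1Norm, rowNormSum, Finset.mul_sum]
  refine Finset.sum_le_sum fun i _ => ?_
  calc ∑ j, |M i j| ≤ ∑ _j : Fin l, ‖(WithLp.toLp q (M i) : PiLp q (fun _ : Fin l => ℝ))‖ :=
        Finset.sum_le_sum fun j _ =>
          PiLp.norm_apply_le (WithLp.toLp q (M i) : PiLp q (fun _ : Fin l => ℝ)) j
    _ = _ := by simp

theorem norm_le_l2Norm (b : Fin m → ℝ) : ‖b‖ ≤ l2Norm b :=
  (pi_norm_le_iff_of_nonneg (l2Norm_nonneg b)).2 fun i =>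
    PiLp.norm_apply_le (WithLp.toLp 2 b : EuclideanSpace ℝ (Fin m)) i

theorem continuous_entry (i : Fin m) (j : Fin l) :
    Continuous fun M : Matrix (Fin m) (Fin l) ℝ => M i j :=
  (Matrix.entryLinearMap ℝ ℝ i j).continuous_of_finiteDimensional

theorem continuous_l1Norm : Continuous (l1Norm : Matrix (Fin m) (Fin l) ℝ → ℝ) :=
  continuous_finsetSum _ fun i _ => continuous_finsetSum _ fun j _ => (continuous_entry i j).abs

theorem continuous_l2Norm : Continuous (l2Norm : (Fin m → ℝ) → ℝ) :=
  (PiLp.continuous_toLp 2 _).norm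

theorem continuous_rowNormSum (q : ℝ≥0∞) [Fact (1 ≤ q)] :
    Continuous (rowNormSum q : Matrix (Fin m) (Fin l) ℝ → ℝ) :=
  continuous_finsetSum _ fun i _ => ((PiLp.continuous_toLp q _).comp
    (continuous_pi fun j => continuous_entry i j)).norm

theorem convexOn_rowNormSum (q : ℝ≥0∞) [Fact (1 ≤ q)] :
    ConvexOn ℝ Set.univ (rowNormSum q : Matrix (Fin m) (Fin l) ℝ → ℝ) := by
  refine ⟨convex_univ, fun M _ N _ a b ha hb _ => ?_⟩
  simp only [rowNormSum, smul_eq_mul, Finset.mul_sum]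
  rw [← Finset.sum_add_distrib]
  refine Finset.sum_le_sum fun i _ => ?_
  have : (WithLp.toLp q ((a • M + b • N) i) : PiLp q (fun _ : Fin l => ℝ))
      = a • WithLp.toLp q (M i) + b • WithLp.toLp q (N i) := rfl
  rw [this]
  refine (norm_add_le _ _).trans ?_
  rw [norm_smul, norm_smul, Real.norm_of_nonneg ha, Real.norm_of_nonneg hb]

end Norms

variable {n p J : ℕ}

/-- The set `𝒟` as a linear subspace. -/
def subspaceD (p J : ℕ) : Submodule ℝ (Matrix (Fin p) (Fin J) ℝ × (Fin J → ℝ)) where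
  carrier := D p J
  add_mem' := by
    rintro x y ⟨hx1, hx2⟩ ⟨hy1, hy2⟩
    exact ⟨by rw [Prod.fst_add, Matrix.add_mulVec, hx1, hy1, add_zero],
      by rw [Prod.snd_add, dotProduct_add, hx2, hy2, add_zero]⟩
  zero_mem' := ⟨Matrix.zero_mulVec _, dotProduct_zero _⟩
  smul_mem' := by
    rintro a x ⟨hx1, hx2⟩
    exact ⟨by rw [Prod.smul_fst, Matrix.smul_mulVec, hx1, smul_zero],
      by rw [Prod.smul_snd, dotProduct_smul, hx2, smul_zero]⟩

/-- The linear part `(W, b) ↦ Xᵀ W + e bᵀ` of the first constraint. -/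
def Model.decision (M : Model n p J) :
    Matrix (Fin p) (Fin J) ℝ × (Fin J → ℝ) →ₗ[ℝ] Matrix (Fin n) (Fin J) ℝ where
  toFun x := M.Xᵀ * x.1 + Matrix.vecMulVec 1 x.2
  map_add' x y := by
    rw [Prod.fst_add, Prod.snd_add, Matrix.mul_add, Matrix.vecMulVec_add]
    abel
  map_smul' a x := by
    rw [Prod.smul_fst, Prod.smul_snd, Matrix.mul_smul, Matrix.vecMulVec_smul, smul_add,
      RingHom.id_apply]

theorem Model.decision_apply (M : Model n p J) (x : Matrix (Fin p) (Fin J) ℝ × (Fin J → ℝ)) :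
    M.decision x = M.Xᵀ * x.1 + Matrix.vecMulVec 1 x.2 := rfl

/-- The weights `c_ij / n` of the hinge losses. -/
noncomputable def Model.weight (M : Model n p J) (ij : Fin n × Fin J) : ℝ :=
  1 / (n : ℝ) * M.c ij.1 ij.2

theorem Model.weight_nonneg (M : Model n p J) (ij : Fin n × Fin J) : 0 ≤ M.weight ij := by
  unfold Model.weight Model.c
  split_ifs <;> positivity

theorem Model.loss_eq (M : Model n p J) (A : Matrix (Fin n) (Fin J) ℝ) :
    M.loss A = ∑ ij : Fin n × Fin J, M.weight ij * max 0 (A ij.1 ij.2) := by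
  simp only [Model.loss, Model.weight, Fintype.sum_prod_type, Finset.mul_sum, mul_assoc]

theorem Model.continuous_loss (M : Model n p J) : Continuous M.loss := by
  have : M.loss = fun A => ∑ ij : Fin n × Fin J, M.weight ij * max 0 (A ij.1 ij.2) := by
    ext A; exact M.loss_eq A
  rw [this]
  exact continuous_finsetSum _ fun ij _ =>
    continuous_const.mul (continuous_const.max (continuous_entry ij.1 ij.2))

/-- Attainment for a regularizer `Ψ` of `W` that bounds `t ‖W‖` linearly, and is zero if
`t = 0`, so that `Ψ` factors through `W ↦ t W`. -/
theorem Model.exists_min (M : Model n p J) (h3 : 0 ≤ M.lam3) (Ψ : Matrix (Fin p) (Fin J) ℝ → ℝ)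
    (hΨc : Continuous Ψ) (hΨ0 : ∀ W, 0 ≤ Ψ W) {t a b : ℝ} (ht : 0 ≤ t) (ha : 0 ≤ a)
    (hΨb : ∀ W, t * ‖W‖ ≤ a * Ψ W + b) (hΨt : t = 0 → ∀ W, Ψ W = 0) :
    ∃ x₀ : subspaceD p J, ∀ x : subspaceD p J,
      M.loss (M.decision x₀.1 + Matrix.of fun _ _ => 1) + Ψ x₀.1.1
          + M.lam3 / 2 * l2Norm x₀.1.2 ^ 2
        ≤ M.loss (M.decision x.1 + Matrix.of fun _ _ => 1) + Ψ x.1.1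
          + M.lam3 / 2 * l2Norm x.1.2 ^ 2 := by
  let W : subspaceD p J →ₗ[ℝ] Matrix (Fin p) (Fin J) ℝ := LinearMap.fst ℝ _ _ ∘ₗ Submodule.subtype _
  let β : subspaceD p J →ₗ[ℝ] (Fin J → ℝ) := LinearMap.snd ℝ _ _ ∘ₗ Submodule.subtype _
  let A : subspaceD p J →ₗ[ℝ] Matrix (Fin n) (Fin J) ℝ := M.decision ∘ₗ Submodule.subtype _
  have hW : Continuous W := W.continuous_of_finiteDimensional
  have hβ : Continuous β := β.continuous_of_finiteDimensional
  have hA : Continuous A := A.continuous_of_finiteDimensional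
  refine exists_forall_le_of_hinge (X := subspaceD p J)
    (F := Matrix (Fin p) (Fin J) ℝ × (Fin J → ℝ)) (ι := Fin n × Fin J)
    ((t • W).prod (M.lam3 • β))
    (LinearMap.pi fun ij => LinearMap.proj ij.2 ∘ₗ LinearMap.proj ij.1 ∘ₗ A)
    (fun _ => 1) M.weight M.weight_nonneg
    (fun x => Ψ (W x) + M.lam3 / 2 * l2Norm (β x) ^ 2)
    (fun x => M.loss (A x + Matrix.of fun _ _ => 1) + Ψ (W x) + M.lam3 / 2 * l2Norm (β x) ^ 2)
    ?_ ?_ ?_ ?_ ?_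
  · exact ((M.continuous_loss.comp (hA.add continuous_const)).add (hΨc.comp hW)).add
      (continuous_const.mul ((continuous_l2Norm.comp hβ).pow 2))
  · intro x
    rw [M.loss_eq]
    simp only [Matrix.add_apply, Matrix.of_apply]
    rw [add_assoc, add_comm]
    rfl
  · intro x
    have := hΨ0 (W x)
    positivity
  · intro x x' hx
    have h1 : t • W x' = t • W x := congrArg Prod.fst hx
    have h2 : M.lam3 • β x' = M.lam3 • β x := congrArg Prod.snd hx
    have e1 : Ψ (W x') = Ψ (W x) := by
      rcases eq_or_ne t 0 with h0 | h0
      · rw [hΨt h0, hΨt h0]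
      · rw [smul_right_injective _ h0 h1]
    have e2 : M.lam3 / 2 * l2Norm (β x') ^ 2 = M.lam3 / 2 * l2Norm (β x) ^ 2 := by
      rcases eq_or_ne M.lam3 0 with h0 | h0
      · simp [h0]
      · rw [smul_right_injective _ h0 h2]
    simp only [e1, e2]
  · intro K
    refine ⟨max (a * K + b) (M.lam3 / 2 + K), fun x hx => ?_⟩
    have q1 := hΨ0 (W x)
    have q2 : 0 ≤ M.lam3 / 2 * l2Norm (β x) ^ 2 := by positivity
    rw [Prod.norm_def]
    refine max_le_max ?_ ?_
    · change ‖t • W x‖ ≤ _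
      rw [norm_smul, Real.norm_of_nonneg ht]
      refine (hΨb _).trans ?_
      gcongr
      linarith
    · change ‖M.lam3 • β x‖ ≤ _
      rw [norm_smul, Real.norm_of_nonneg h3]
      have := mul_le_mul_of_nonneg_left (norm_le_l2Norm (β x)) h3
      nlinarith [mul_nonneg h3 (sq_nonneg (l2Norm (β x) - 1))]

/-- The smooth part of both objectives is `‖(s W, t b)‖ ^ 2 / 2` for this map. -/
def ridgeMap (p J : ℕ) (s t : ℝ) : subspaceD p J →ₗ[ℝ] EuclideanSpace ℝ (Fin p × Fin J ⊕ Fin J) where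
  toFun x := WithLp.toLp 2 (Sum.elim (fun ij => s * x.1.1 ij.1 ij.2) fun j => t * x.1.2 j)
  map_add' x y := by ext (i | j) <;> simp [mul_add]
  map_smul' a x := by ext (i | j) <;> simp <;> ring

theorem norm_ridgeMap_sq (s t : ℝ) (x : subspaceD p J) :
    ‖ridgeMap p J s t x‖ ^ 2 = s ^ 2 * ‖x.1.1‖ ^ 2 + t ^ 2 * l2Norm x.1.2 ^ 2 := by
  simp [ridgeMap, EuclideanSpace.real_norm_sq_eq, norm_sq_eq_sum, l2Norm_sq, Fintype.sum_prod_type,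
    Finset.mul_sum, mul_pow]

/-- The pair `(s A, t U)` as one Euclidean vector. -/
def packTwo (n p J : ℕ) (s t : ℝ) : Matrix (Fin n) (Fin J) ℝ × Matrix (Fin p) (Fin J) ℝ →ₗ[ℝ]
    EuclideanSpace ℝ (Fin n × Fin J ⊕ Fin p × Fin J) where
  toFun x := WithLp.toLp 2 (Sum.elim (fun ij => s * x.1 ij.1 ij.2) fun ij => t * x.2 ij.1 ij.2)
  map_add' x y := by ext (i | j) <;> simp [mul_add]
  map_smul' a x := by ext (i | j) <;> simp <;> ring

theorem inner_packTwo (s t s' t' : ℝ) (A A' : Matrix (Fin n) (Fin J) ℝ)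
    (U U' : Matrix (Fin p) (Fin J) ℝ) :
    inner ℝ (packTwo n p J s t (A, U)) (packTwo n p J s' t' (A', U'))
      = s * s' * frobInner A A' + t * t' * frobInner U U' := by
  simp only [packTwo, LinearMap.coe_mk, AddHom.coe_mk, PiLp.inner_apply, Fintype.sum_sum_type,
    Fintype.sum_prod_type, Sum.elim_inl, Sum.elim_inr, RCLike.inner_apply, conj_trivial,
    frobInner_eq_sum, Finset.mul_sum]
  congr 1 <;> refine Finset.sum_congr rfl fun i _ => Finset.sum_congr rfl fun j _ => ?_ <;> ring

theorem norm_packTwo_sq (s t : ℝ) (A : Matrix (Fin n) (Fin J) ℝ) (U : Matrix (Fin p) (Fin J) ℝ) :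
    ‖packTwo n p J s t (A, U)‖ ^ 2 = s ^ 2 * ‖A‖ ^ 2 + t ^ 2 * ‖U‖ ^ 2 := by
  rw [← real_inner_self_eq_norm_sq, inner_packTwo, frobInner_self, frobInner_self, sq s, sq t]

theorem packTwo_surjective {s t : ℝ} (hs : s ≠ 0) (ht : t ≠ 0)
    (y : EuclideanSpace ℝ (Fin n × Fin J ⊕ Fin p × Fin J)) :
    ∃ A U, packTwo n p J s t (A, U) = y := by
  refine ⟨Matrix.of fun i j => y (Sum.inl (i, j)) / s, Matrix.of fun i j => y (Sum.inr (i, j)) / t,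
    ?_⟩
  ext (i | j) <;> simp [packTwo, mul_div_cancel₀, hs, ht]

/-- The triple `(s A, t U, r V)` as one Euclidean vector. -/
def packThree (n p J : ℕ) (s t r : ℝ) :
    Matrix (Fin n) (Fin J) ℝ × Matrix (Fin p) (Fin J) ℝ × Matrix (Fin p) (Fin J) ℝ →ₗ[ℝ]
    EuclideanSpace ℝ (Fin n × Fin J ⊕ (Fin p × Fin J ⊕ Fin p × Fin J)) where
  toFun x := WithLp.toLp 2 (Sum.elim (fun ij => s * x.1 ij.1 ij.2)
    (Sum.elim (fun ij => t * x.2.1 ij.1 ij.2) fun ij => r * x.2.2 ij.1 ij.2))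
  map_add' x y := by ext (i | i | j) <;> simp [mul_add]
  map_smul' a x := by ext (i | i | j) <;> simp <;> ring

theorem inner_packThree (s t r s' t' r' : ℝ) (A A' : Matrix (Fin n) (Fin J) ℝ)
    (U U' V V' : Matrix (Fin p) (Fin J) ℝ) :
    inner ℝ (packThree n p J s t r (A, U, V)) (packThree n p J s' t' r' (A', U', V'))
      = s * s' * frobInner A A' + (t * t' * frobInner U U' + r * r' * frobInner V V') := by
  simp only [packThree, LinearMap.coe_mk, AddHom.coe_mk, PiLp.inner_apply, Fintype.sum_sum_type,
    Fintype.sum_prod_type, Sum.elim_inl, Sum.elim_inr, RCLike.inner_apply, conj_trivial,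
    frobInner_eq_sum, Finset.mul_sum]
  congr 1
  · refine Finset.sum_congr rfl fun i _ => Finset.sum_congr rfl fun j _ => ?_
    ring
  · congr 1 <;> refine Finset.sum_congr rfl fun i _ => Finset.sum_congr rfl fun j _ => ?_ <;> ring

theorem norm_packThree_sq (s t r : ℝ) (A : Matrix (Fin n) (Fin J) ℝ)
    (U V : Matrix (Fin p) (Fin J) ℝ) :
    ‖packThree n p J s t r (A, U, V)‖ ^ 2
      = s ^ 2 * ‖A‖ ^ 2 + (t ^ 2 * ‖U‖ ^ 2 + r ^ 2 * ‖V‖ ^ 2) := by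
  rw [← real_inner_self_eq_norm_sq, inner_packThree, frobInner_self, frobInner_self,
    frobInner_self, sq s, sq t, sq r]

theorem packThree_surjective {s t r : ℝ} (hs : s ≠ 0) (ht : t ≠ 0) (hr : r ≠ 0)
    (y : EuclideanSpace ℝ (Fin n × Fin J ⊕ (Fin p × Fin J ⊕ Fin p × Fin J))) :
    ∃ A U V, packThree n p J s t r (A, U, V) = y := by
  refine ⟨Matrix.of fun i j => y (Sum.inl (i, j)) / s,
    Matrix.of fun i j => y (Sum.inr (Sum.inl (i, j))) / t,
    Matrix.of fun i j => y (Sum.inr (Sum.inr (i, j))) / r, ?_⟩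
  ext (i | i | j) <;> simp [packThree, mul_div_cancel₀, hs, ht, hr]

theorem mul_max_zero_eq {w s a : ℝ} (hw : 0 ≤ w) (hs : s ≠ 0) :
    max (0 * (s * a)) (w / s * (s * a)) = w * max 0 a := by
  rw [zero_mul, ← mul_assoc, div_mul_cancel₀ _ hs, mul_max_of_nonneg _ _ hw, mul_zero]

theorem max_neg_mul_eq {w s a : ℝ} (hw : 0 ≤ w) (hs : s ≠ 0) :
    max (-(w / s) * (s * a)) (w / s * (s * a)) = w * |a| := by
  rw [neg_mul, ← mul_assoc, div_mul_cancel₀ _ hs, max_comm, ← abs_eq_max_neg, abs_mul,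
    abs_of_nonneg hw]

theorem inv_sqrt_mul_self (a : ℝ) : (√a)⁻¹ * a = √a := by
  rw [inv_mul_eq_div, Real.div_sqrt]

section ElasticNet

variable (M : Model n p J) (α μ : ℝ)

/-- The lower slopes of the polyhedral part of the elastic-net objective. -/
noncomputable def lowerSlope1 : Fin n × Fin J ⊕ Fin p × Fin J → ℝ :=
  Sum.elim (fun _ => 0) fun _ => -(M.lam1 / √μ)

/-- The upper slopes of the polyhedral part of the elastic-net objective. -/
noncomputable def upperSlope1 : Fin n × Fin J ⊕ Fin p × Fin J → ℝ :=
  Sum.elim (fun ij => M.weight ij / √α) fun _ => M.lam1 / √μ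

/-- The nonsmooth part of the elastic-net objective, in the scaled variable `(√α A, √μ U)`. -/
noncomputable def theta1 (y : EuclideanSpace ℝ (Fin n × Fin J ⊕ Fin p × Fin J)) : ℝ :=
  ∑ i, max (lowerSlope1 M μ i * y i) (upperSlope1 M α μ i * y i)

/-- The linear part of the elastic-net constraints `A = Xᵀ W + e bᵀ + E`, `U = W`, scaled. -/
noncomputable def constraint1 :
    subspaceD p J →ₗ[ℝ] EuclideanSpace ℝ (Fin n × Fin J ⊕ Fin p × Fin J) :=
  packTwo n p J (√α) (√μ) ∘ₗ
    (M.decision.prod (LinearMap.fst ℝ _ _)) ∘ₗ Submodule.subtype _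

/-- The constant part of the same constraints. -/
noncomputable def offset1 (n p J : ℕ) (α μ : ℝ) :
    EuclideanSpace ℝ (Fin n × Fin J ⊕ Fin p × Fin J) :=
  packTwo n p J (√α) (√μ) (Matrix.of fun _ _ => 1, 0)

theorem theta1_packTwo (h1 : 0 ≤ M.lam1) {α μ : ℝ} (hα : 0 < α) (hμ : 0 < μ)
    (A : Matrix (Fin n) (Fin J) ℝ) (U : Matrix (Fin p) (Fin J) ℝ) :
    theta1 M α μ (packTwo n p J (√α) (√μ) (A, U)) = M.loss A + M.lam1 * l1Norm U := by
  have hα' : √α ≠ 0 := (Real.sqrt_pos.2 hα).ne'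
  have hμ' : √μ ≠ 0 := (Real.sqrt_pos.2 hμ).ne'
  simp only [theta1, lowerSlope1, upperSlope1, packTwo, LinearMap.coe_mk, AddHom.coe_mk,
    Fintype.sum_sum_type, Sum.elim_inl, Sum.elim_inr, mul_max_zero_eq (M.weight_nonneg _) hα',
    max_neg_mul_eq h1 hμ']
  rw [M.loss_eq, l1Norm, Finset.mul_sum, Fintype.sum_prod_type (f := fun ij => M.lam1 * _)]
  simp only [Finset.mul_sum]

theorem constraint1_add (x : subspaceD p J) :
    constraint1 M α μ x + offset1 n p J α μ
      = packTwo n p J (√α) (√μ) (M.decision x.1 + Matrix.of fun _ _ => 1, x.1.1) := by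
  change packTwo n p J (√α) (√μ) (M.decision x.1, x.1.1) + offset1 n p J α μ = _
  rw [offset1, ← map_add, Prod.mk_add_mk, add_zero]

theorem constraint1_sub (W : Matrix (Fin p) (Fin J) ℝ) (b : Fin J → ℝ) (h : (W, b) ∈ D p J)
    (A : Matrix (Fin n) (Fin J) ℝ) (U : Matrix (Fin p) (Fin J) ℝ) :
    constraint1 M α μ ⟨(W, b), h⟩ + offset1 n p J α μ - packTwo n p J (√α) (√μ) (A, U)
      = packTwo n p J (√α) (√μ) (M.res W b A, W - U) := by
  rw [constraint1_add, ← map_sub, Prod.mk_sub_mk]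
  rfl

variable {α μ}

theorem F1_eq (h1 : 0 ≤ M.lam1) (h2 : 0 ≤ M.lam2) (h3 : 0 ≤ M.lam3) (hα : 0 < α) (hμ : 0 < μ)
    (W : Matrix (Fin p) (Fin J) ℝ) (b : Fin J → ℝ) (h : (W, b) ∈ D p J)
    (A : Matrix (Fin n) (Fin J) ℝ) (U : Matrix (Fin p) (Fin J) ℝ) :
    M.F1 W b A U = ‖ridgeMap p J (√M.lam2) (√M.lam3) ⟨(W, b), h⟩‖ ^ 2 / 2
      + theta1 M α μ (packTwo n p J (√α) (√μ) (A, U)) := by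
  rw [theta1_packTwo M h1 hα hμ, norm_ridgeMap_sq, Real.sq_sqrt h2, Real.sq_sqrt h3, Model.F1]
  ring

/-- Completing the square: the multipliers enter as `u = (Π / √α, Λ / √μ)`. -/
theorem L1_eq (h1 : 0 ≤ M.lam1) (h2 : 0 ≤ M.lam2) (h3 : 0 ≤ M.lam3) (hα : 0 < α) (hμ : 0 < μ)
    (W : Matrix (Fin p) (Fin J) ℝ) (b : Fin J → ℝ) (h : (W, b) ∈ D p J)
    (A : Matrix (Fin n) (Fin J) ℝ) (U : Matrix (Fin p) (Fin J) ℝ)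
    (Pm : Matrix (Fin n) (Fin J) ℝ) (Lm : Matrix (Fin p) (Fin J) ℝ) :
    M.L1 α μ W b A U Pm Lm = ‖ridgeMap p J (√M.lam2) (√M.lam3) ⟨(W, b), h⟩‖ ^ 2 / 2
      + theta1 M α μ (packTwo n p J (√α) (√μ) (A, U))
      + ‖constraint1 M α μ ⟨(W, b), h⟩ + offset1 n p J α μ - packTwo n p J (√α) (√μ) (A, U)
          + packTwo n p J (√α)⁻¹ (√μ)⁻¹ (Pm, Lm)‖ ^ 2 / 2
      - ‖packTwo n p J (√α)⁻¹ (√μ)⁻¹ (Pm, Lm)‖ ^ 2 / 2 := by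
  rw [constraint1_sub, norm_add_sq_real, inner_packTwo, norm_packTwo_sq,
    mul_inv_cancel₀ (Real.sqrt_pos.2 hα).ne', mul_inv_cancel₀ (Real.sqrt_pos.2 hμ).ne',
    Real.sq_sqrt hα.le, Real.sq_sqrt hμ.le, ← F1_eq M h1 h2 h3 hα hμ, Model.L1,
    frobInner_comm _ Pm, frobInner_comm _ Lm]
  ring

theorem isADMMStep_of_step1 (h1 : 0 ≤ M.lam1) (h2 : 0 ≤ M.lam2) (h3 : 0 ≤ M.lam3) (hα : 0 < α)
    (hμ : 0 < μ) {z z' : State1 n p J} (h : M.Step1 α μ z z') :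
    IsADMMStep (constraint1 M α μ) (ridgeMap p J (√M.lam2) (√M.lam3)) (offset1 n p J α μ)
      (theta1 M α μ) (packTwo n p J (√α) (√μ) (z.A, z.U))
      (packTwo n p J (√α)⁻¹ (√μ)⁻¹ (z.Pm, z.Lm)) ⟨(z'.W, z'.b), h.mem_D⟩
      (packTwo n p J (√α) (√μ) (z'.A, z'.U)) (packTwo n p J (√α)⁻¹ (√μ)⁻¹ (z'.Pm, z'.Lm)) where
  min_x := by
    rintro ⟨⟨W, b⟩, hWb⟩
    have := h.min_Wb W b hWb
    rw [L1_eq M h1 h2 h3 hα hμ _ _ h.mem_D, L1_eq M h1 h2 h3 hα hμ _ _ hWb] at this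
    linarith
  min_y := by
    intro v
    obtain ⟨A, U, rfl⟩ := packTwo_surjective (Real.sqrt_pos.2 hα).ne' (Real.sqrt_pos.2 hμ).ne' v
    have := h.min_AU A U
    rw [L1_eq M h1 h2 h3 hα hμ _ _ h.mem_D, L1_eq M h1 h2 h3 hα hμ _ _ h.mem_D] at this
    linarith
  update := by
    rw [constraint1_sub, h.update_Pm, h.update_Lm]
    ext (i | i)
    · simp [packTwo, mul_add, ← mul_assoc, inv_sqrt_mul_self]
    · simp [packTwo, mul_add, ← mul_assoc, inv_sqrt_mul_self]

theorem exists_min1 (h1 : 0 ≤ M.lam1) (h2 : 0 ≤ M.lam2) (h3 : 0 ≤ M.lam3) (hα : 0 < α)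
    (hμ : 0 < μ) :
    ∃ x₀ : subspaceD p J, ∀ x : subspaceD p J,
      ‖ridgeMap p J (√M.lam2) (√M.lam3) x₀‖ ^ 2 / 2
          + theta1 M α μ (constraint1 M α μ x₀ + offset1 n p J α μ)
        ≤ ‖ridgeMap p J (√M.lam2) (√M.lam3) x‖ ^ 2 / 2
          + theta1 M α μ (constraint1 M α μ x + offset1 n p J α μ) := by
  obtain ⟨x₀, hx₀⟩ := M.exists_min h3 (fun W => M.lam1 * l1Norm W + M.lam2 / 2 * ‖W‖ ^ 2)
    ((continuous_const.mul continuous_l1Norm).add (continuous_const.mul (continuous_norm.pow 2)))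
    (fun W => by have := l1Norm_nonneg W; positivity)
    (t := M.lam1 + M.lam2) (a := 1) (b := M.lam2 / 2) (by positivity) zero_le_one
    (fun W => by
      have e1 := mul_le_mul_of_nonneg_left (norm_le_l1Norm W) h1
      nlinarith [mul_nonneg h2 (sq_nonneg (‖W‖ - 1))])
    (fun h W => by
      have e1 : M.lam1 = 0 := by linarith
      have e2 : M.lam2 = 0 := by linarith
      simp [e1, e2])
  refine ⟨x₀, fun x => ?_⟩
  have := hx₀ x
  simp only [constraint1_add, theta1_packTwo M h1 hα hμ, norm_ridgeMap_sq, Real.sq_sqrt h2,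
    Real.sq_sqrt h3]
  linarith

theorem constraint1_injective (hn : 0 < n) (hα : 0 < α) (hμ : 0 < μ) :
    Function.Injective (constraint1 M α μ) := by
  rw [← LinearMap.ker_eq_bot, LinearMap.ker_eq_bot']
  rintro ⟨⟨W, b⟩, h⟩ hx
  have h0 := norm_packTwo_sq (√α) (√μ) (M.decision (W, b)) W
  rw [show packTwo n p J (√α) (√μ) (M.decision (W, b), W) = 0 from hx, norm_zero,
    Real.sq_sqrt hα.le, Real.sq_sqrt hμ.le] at h0
  have hA0 : ‖M.decision (W, b)‖ ^ 2 = 0 := by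
    nlinarith [mul_nonneg hα.le (sq_nonneg ‖M.decision (W, b)‖), mul_nonneg hμ.le (sq_nonneg ‖W‖)]
  have hW0 : ‖W‖ ^ 2 = 0 := by
    nlinarith [mul_nonneg hα.le (sq_nonneg ‖M.decision (W, b)‖), mul_nonneg hμ.le (sq_nonneg ‖W‖)]
  have hW : W = 0 := by simpa using hW0
  have hA : M.decision (W, b) = 0 := by simpa using hA0
  have hb : b = 0 := by
    ext j
    have := congrFun (congrFun hA ⟨0, hn⟩) j
    simpa [Model.decision_apply, hW, Matrix.vecMulVec_apply] using this
  subst hW hb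
  rfl

theorem ridgeMap_injective {s t : ℝ} (hs : s ≠ 0) (ht : t ≠ 0) :
    Function.Injective (ridgeMap p J s t) := by
  rw [← LinearMap.ker_eq_bot, LinearMap.ker_eq_bot']
  rintro ⟨⟨W, b⟩, h⟩ hx
  have hW : W = 0 := by
    ext i j
    have := congrArg (fun y => y (Sum.inl (i, j))) hx
    simpa [ridgeMap, hs] using this
  have hb : b = 0 := by
    ext j
    have := congrArg (fun y => y (Sum.inr j)) hx
    simpa [ridgeMap, ht] using this
  subst hW hb
  rfl

theorem exists_norm_le_mul_norm {X Y Z : Type*} [NormedAddCommGroup X] [NormedSpace ℝ X]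
    [FiniteDimensional ℝ X] [NormedAddCommGroup Y] [NormedSpace ℝ Y] [NormedAddCommGroup Z]
    [NormedSpace ℝ Z] (S : X →ₗ[ℝ] Y) {T : X →ₗ[ℝ] Z} (hT : Function.Injective T) :
    ∃ K : ℝ, ∀ x, ‖S x‖ ≤ K * ‖T x‖ := by
  obtain ⟨K, -, hK⟩ := T.exists_antilipschitzWith (LinearMap.ker_eq_bot.2 hT)
  refine ⟨‖LinearMap.toContinuousLinearMap S‖ * K, fun x => ?_⟩
  have h1 := (LinearMap.toContinuousLinearMap S).le_opNorm x
  have h2 := hK.le_mul_dist x 0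
  simp only [map_zero, dist_zero_right] at h2
  rw [mul_assoc]
  exact h1.trans (by gcongr)

end ElasticNet

/-! ### Convergence for the elastic-net model -/

theorem tendsto_zero_of_sq_le {a b : ℕ → ℝ} {s : ℝ} (hs : 0 < s) (ha : ∀ k, 0 ≤ a k)
    (hb0 : ∀ k, 0 ≤ b k) (hab : ∀ k, s * a k ^ 2 ≤ b k ^ 2) (hb : Tendsto b atTop (𝓝 0)) :
    Tendsto a atTop (𝓝 0) := by
  have hs' := Real.sqrt_pos.2 hs
  refine squeeze_zero ha (fun k => ?_) (by simpa using hb.const_mul (√s)⁻¹)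
  rw [le_inv_mul_iff₀ hs']
  refine le_of_sq_le_sq ?_ (hb0 k)
  rw [mul_pow, Real.sq_sqrt hs.le]
  exact hab k

/-- A geometric bound on a tail extends to the whole sequence. -/
theorem exists_geometric_bound {a : ℕ → ℝ} {C ρ : ℝ} (N : ℕ) (hρ : 0 < ρ)
    (h : ∀ m, a (N + m) ≤ C * ρ ^ m) : ∃ C', ∀ k, a k ≤ C' * ρ ^ k := by
  have hsum : 0 ≤ ∑ i ∈ Finset.range N, |a i| / ρ ^ i :=
    Finset.sum_nonneg fun i _ => by positivity
  refine ⟨|C| / ρ ^ N + ∑ i ∈ Finset.range N, |a i| / ρ ^ i, fun k => ?_⟩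
  rw [add_mul]
  rcases lt_or_ge k N with hk | hk
  · have h1 := Finset.single_le_sum (f := fun i => |a i| / ρ ^ i) (fun i _ => by positivity)
      (Finset.mem_range.2 hk)
    have h2 := mul_le_mul_of_nonneg_right h1 (pow_pos hρ k).le
    rw [div_mul_cancel₀ _ (pow_pos hρ k).ne'] at h2
    have h3 : 0 ≤ |C| / ρ ^ N * ρ ^ k := by positivity
    linarith [le_abs_self (a k)]
  · obtain ⟨m, rfl⟩ := Nat.exists_eq_add_of_le hk
    have h1 : |C| / ρ ^ N * ρ ^ (N + m) = |C| * ρ ^ m := by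
      rw [pow_add]; field_simp
    have h2 : C * ρ ^ m ≤ |C| * ρ ^ m :=
      mul_le_mul_of_nonneg_right (le_abs_self C) (pow_pos hρ m).le
    have h3 : 0 ≤ (∑ i ∈ Finset.range N, |a i| / ρ ^ i) * ρ ^ (N + m) := by positivity
    rw [h1]
    linarith [h m]

section ElasticNet

variable (M : Model n p J) {α μ : ℝ}

theorem convexOn_theta1 : ConvexOn ℝ Set.univ (theta1 M α μ) := convexOn_sum_max_mul _ _

theorem continuous_theta1 : Continuous (theta1 M α μ) := by
  unfold theta1
  fun_prop

/-- The limit point has the primal solution and the limit of the multipliers as components. -/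
theorem convergesLinearly_of_step1 (hn : 0 < n) (h1 : 0 ≤ M.lam1) (h2 : 0 < M.lam2)
    (h3 : 0 < M.lam3) (hα : 0 < α) (hμ : 0 < μ) {z : ℕ → State1 n p J}
    (hz : ∀ k, M.Step1 α μ (z k) (z (k + 1))) {xs : subspaceD p J}
    {us : EuclideanSpace ℝ (Fin n × Fin J ⊕ Fin p × Fin J)}
    (hs : IsKKT (constraint1 M α μ) (ridgeMap p J (√M.lam2) (√M.lam3)) (offset1 n p J α μ)
      (theta1 M α μ) xs us) : ConvergesLinearly z := by
  obtain ⟨K₁, hK₁⟩ := exists_norm_le_mul_norm (constraint1 M α μ)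
    (ridgeMap_injective (p := p) (J := J) (Real.sqrt_pos.2 h2).ne' (Real.sqrt_pos.2 h3).ne')
  obtain ⟨K₂, hK₂⟩ := exists_norm_le_mul_norm (ridgeMap p J (√M.lam2) (√M.lam3))
    (constraint1_injective M hn hα hμ)
  obtain ⟨ul, C, ρ, N, hρ0, hρ1, hrate⟩ := exists_linear_rate _ _ hK₁ hK₂
    (fun k => isADMMStep_of_step1 M h1 h2.le h3.le hα hμ (hz k)) hs
  obtain ⟨Ps, Ls, hPL⟩ := packTwo_surjective (inv_pos.2 (Real.sqrt_pos.2 hα)).ne'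
    (inv_pos.2 (Real.sqrt_pos.2 hμ)).ne' ul
  let w : State1 n p J :=
    ⟨xs.1.1, xs.1.2, M.decision xs.1 + Matrix.of fun _ _ => 1, xs.1.1, Ps, Ls⟩
  set K : ℝ := 1 / M.lam2 + 1 / M.lam3 + 1 / α + 1 / μ + α + μ with hK
  have hbound : ∀ m, (z (N + 1 + m)).distance w ≤ √K * |C| * ρ ^ m := by
    intro m
    obtain ⟨r1, r2, r3⟩ := hrate m
    rw [show N + 1 + m = N + m + 1 by ring]
    set T := |C| * ρ ^ m with hT
    have hCT : C * ρ ^ m ≤ T := mul_le_mul_of_nonneg_right (le_abs_self C) (pow_pos hρ0 m).le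
    have s1 := pow_le_pow_left₀ (norm_nonneg _) (r1.trans hCT) 2
    have s2 := pow_le_pow_left₀ (norm_nonneg _) (r2.trans hCT) 2
    have s3 := pow_le_pow_left₀ (norm_nonneg _) (r3.trans hCT) 2
    rw [norm_ridgeMap_sq, Real.sq_sqrt h2.le, Real.sq_sqrt h3.le] at s1
    rw [constraint1_add, ← map_sub, Prod.mk_sub_mk, norm_packTwo_sq, Real.sq_sqrt hα.le,
      Real.sq_sqrt hμ.le] at s2
    rw [← hPL, ← map_sub, Prod.mk_sub_mk, norm_packTwo_sq, inv_pow, inv_pow, Real.sq_sqrt hα.le,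
      Real.sq_sqrt hμ.le] at s3
    have s1' : M.lam2 * ‖(z (N + m + 1)).W - w.W‖ ^ 2
        + M.lam3 * l2Norm ((z (N + m + 1)).b - w.b) ^ 2 ≤ T ^ 2 := s1
    have s2' : α * ‖(z (N + m + 1)).A - w.A‖ ^ 2 + μ * ‖(z (N + m + 1)).U - w.U‖ ^ 2 ≤ T ^ 2 := s2
    have s3' : α⁻¹ * ‖(z (N + m + 1)).Pm - w.Pm‖ ^ 2 + μ⁻¹ * ‖(z (N + m + 1)).Lm - w.Lm‖ ^ 2
        ≤ T ^ 2 := s3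
    have drop : ∀ {a b x y : ℝ}, 0 < a → 0 < b → a * x ^ 2 + b * y ^ 2 ≤ T ^ 2 →
        x ^ 2 ≤ 1 / a * T ^ 2 ∧ y ^ 2 ≤ 1 / b * T ^ 2 := by
      intro a b x y ha hb hab
      have e1 := mul_nonneg ha.le (sq_nonneg x)
      have e2 := mul_nonneg hb.le (sq_nonneg y)
      rw [one_div, one_div, le_inv_mul_iff₀ ha, le_inv_mul_iff₀ hb]
      exact ⟨by linarith, by linarith⟩
    obtain ⟨t1, t2⟩ := drop h2 h3 s1'
    obtain ⟨t3, t4⟩ := drop hα hμ s2'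
    obtain ⟨t5, t6⟩ := drop (inv_pos.2 hα) (inv_pos.2 hμ) s3'
    rw [one_div, inv_inv] at t5 t6
    have hT0 : 0 ≤ T := by positivity
    have hK0 : 0 ≤ K := by positivity
    rw [mul_assoc, ← hT, State1.distance, ← Real.sqrt_sq hT0, ← Real.sqrt_mul hK0]
    refine Real.sqrt_le_sqrt ?_
    rw [hK]
    linarith
  obtain ⟨C', hC'⟩ := exists_geometric_bound (a := fun k => (z k).distance w) (N + 1) hρ0 hbound
  exact ⟨w, C', ρ, hρ0, hρ1, hC'⟩

theorem elasticNet_convergence (hn : 0 < n) (h1 : 0 ≤ M.lam1) (h2 : 0 ≤ M.lam2) (h3 : 0 ≤ M.lam3)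
    (hα : 0 < α) (hμ : 0 < μ) :
    ∃ F1star : ℝ, IsLeast M.values1 F1star ∧
      ∀ z : ℕ → State1 n p J, (∀ k, M.Step1 α μ (z k) (z (k + 1))) →
        Tendsto (fun k => M.F1 (z k).W (z k).b (z k).A (z k).U) atTop (𝓝 F1star) ∧
        Tendsto (fun k => ‖M.res (z k).W (z k).b (z k).A‖) atTop (𝓝 0) ∧
        Tendsto (fun k => ‖(z k).W - (z k).U‖) atTop (𝓝 0) ∧
        (0 < M.lam2 → 0 < M.lam3 → ConvergesLinearly z) := by
  obtain ⟨xs, hxs⟩ := exists_min1 M h1 h2 h3 hα hμ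
  obtain ⟨us, hs⟩ := exists_isKKT (convexOn_theta1 M) (continuous_theta1 M) hxs
  have hval : ∀ x : subspaceD p J, ‖ridgeMap p J (√M.lam2) (√M.lam3) x‖ ^ 2 / 2
      + theta1 M α μ (constraint1 M α μ x + offset1 n p J α μ)
      = M.F1 x.1.1 x.1.2 (M.decision x.1 + Matrix.of fun _ _ => 1) x.1.1 := fun x => by
    rw [constraint1_add, F1_eq M h1 h2 h3 hα hμ _ _ x.2]
  refine ⟨_, ⟨⟨xs.1.1, xs.1.2, _, _, xs.2, rfl, rfl, hval xs⟩, ?_⟩, fun z hz => ?_⟩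
  · rintro _ ⟨W, b, A, U, hWb, rfl, rfl, rfl⟩
    have := hxs ⟨(U, b), hWb⟩
    rw [hval ⟨(U, b), hWb⟩] at this
    exact this
  · obtain ⟨hres, hobj⟩ := tendsto_of_isADMMStep (convexOn_theta1 M)
      (fun k => isADMMStep_of_step1 M h1 h2 h3 hα hμ (hz k)) hs
    simp only [constraint1_sub] at hres
    have hsq : ∀ k, ‖packTwo n p J (√α) (√μ) (M.res (z (k + 1)).W (z (k + 1)).b (z (k + 1)).A,
        (z (k + 1)).W - (z (k + 1)).U)‖ ^ 2
        = α * ‖M.res (z (k + 1)).W (z (k + 1)).b (z (k + 1)).A‖ ^ 2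
          + μ * ‖(z (k + 1)).W - (z (k + 1)).U‖ ^ 2 := fun k => by
      rw [norm_packTwo_sq, Real.sq_sqrt hα.le, Real.sq_sqrt hμ.le]
    refine ⟨?_, ?_, ?_, fun h2' h3' => convergesLinearly_of_step1 M hn h1 h2' h3' hα hμ hz hs⟩
    · refine (tendsto_add_atTop_iff_nat 1).1 (hobj.congr fun k => ?_)
      rw [F1_eq M h1 h2 h3 hα hμ _ _ (hz k).mem_D]
    · refine (tendsto_add_atTop_iff_nat 1).1 (tendsto_zero_of_sq_le hα (fun k => norm_nonneg _)
        (fun k => norm_nonneg _) (fun k => ?_) hres)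
      rw [hsq]
      exact le_add_of_nonneg_right (by positivity)
    · refine (tendsto_add_atTop_iff_nat 1).1 (tendsto_zero_of_sq_le hμ (fun k => norm_nonneg _)
        (fun k => norm_nonneg _) (fun k => ?_) hres)
      rw [hsq]
      exact le_add_of_nonneg_left (by positivity)

end ElasticNet

/-! ### The row-norm models -/

section RowNorm

variable (M : Model n p J) (q : ℝ≥0∞) (α μ ν : ℝ)

/-- The first two blocks of a vector of three blocks. -/
def blocksAU (n p J : ℕ) : EuclideanSpace ℝ (Fin n × Fin J ⊕ (Fin p × Fin J ⊕ Fin p × Fin J)) →ₗ[ℝ]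
    EuclideanSpace ℝ (Fin n × Fin J ⊕ Fin p × Fin J) where
  toFun y := WithLp.toLp 2 (Sum.elim (fun ij => y (Sum.inl ij)) fun ij => y (Sum.inr (Sum.inl ij)))
  map_add' x y := by ext (i | i) <;> simp
  map_smul' a x := by ext (i | i) <;> simp

/-- The third block of a vector of three blocks, divided by `r`. -/
noncomputable def blockV (n p J : ℕ) (r : ℝ) :
    EuclideanSpace ℝ (Fin n × Fin J ⊕ (Fin p × Fin J ⊕ Fin p × Fin J)) →ₗ[ℝ]
      Matrix (Fin p) (Fin J) ℝ where
  toFun y := Matrix.of fun i j => y (Sum.inr (Sum.inr (i, j))) / r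
  map_add' x y := by ext i j; simp [add_div]
  map_smul' a x := by ext i j; simp [mul_div_assoc]

/-- The nonsmooth part of the objective with the row-norm regularizer, in the scaled variable
`(√α A, √μ U, √ν V)`. -/
noncomputable def theta2
    (y : EuclideanSpace ℝ (Fin n × Fin J ⊕ (Fin p × Fin J ⊕ Fin p × Fin J))) : ℝ :=
  theta1 M α μ (blocksAU n p J y) + M.lam2 * rowNormSum q (blockV n p J (√ν) y)

/-- The linear part of the constraints `A = Xᵀ W + e bᵀ + E`, `U = W`, `V = W`, scaled. -/
noncomputable def constraint2 :
    subspaceD p J →ₗ[ℝ] EuclideanSpace ℝ (Fin n × Fin J ⊕ (Fin p × Fin J ⊕ Fin p × Fin J)) :=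
  packThree n p J (√α) (√μ) (√ν) ∘ₗ
    (M.decision.prod ((LinearMap.fst ℝ _ _).prod (LinearMap.fst ℝ _ _))) ∘ₗ Submodule.subtype _

/-- The constant part of the same constraints. -/
noncomputable def offset2 (n p J : ℕ) (α μ ν : ℝ) :
    EuclideanSpace ℝ (Fin n × Fin J ⊕ (Fin p × Fin J ⊕ Fin p × Fin J)) :=
  packThree n p J (√α) (√μ) (√ν) (Matrix.of fun _ _ => 1, 0, 0)

theorem constraint2_add (x : subspaceD p J) :
    constraint2 M α μ ν x + offset2 n p J α μ ν
      = packThree n p J (√α) (√μ) (√ν)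
          (M.decision x.1 + Matrix.of fun _ _ => 1, x.1.1, x.1.1) := by
  change packThree n p J (√α) (√μ) (√ν) (M.decision x.1, x.1.1, x.1.1) + offset2 n p J α μ ν = _
  rw [offset2, ← map_add, Prod.mk_add_mk, Prod.mk_add_mk, add_zero]

theorem constraint2_sub (W : Matrix (Fin p) (Fin J) ℝ) (b : Fin J → ℝ) (h : (W, b) ∈ D p J)
    (A : Matrix (Fin n) (Fin J) ℝ) (U V : Matrix (Fin p) (Fin J) ℝ) :
    constraint2 M α μ ν ⟨(W, b), h⟩ + offset2 n p J α μ ν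
        - packThree n p J (√α) (√μ) (√ν) (A, U, V)
      = packThree n p J (√α) (√μ) (√ν) (M.res W b A, W - U, W - V) := by
  rw [constraint2_add, ← map_sub, Prod.mk_sub_mk, Prod.mk_sub_mk]
  rfl

theorem convexOn_theta2 [Fact (1 ≤ q)] (h2 : 0 ≤ M.lam2) :
    ConvexOn ℝ Set.univ (theta2 M q α μ ν) :=
  ((convexOn_theta1 M).comp_linearMap (blocksAU n p J)).add
    (((convexOn_rowNormSum q).comp_linearMap (blockV n p J (√ν))).smul h2)

theorem continuous_theta2 [Fact (1 ≤ q)] : Continuous (theta2 M q α μ ν) :=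
  ((continuous_theta1 M).comp (blocksAU n p J).continuous_of_finiteDimensional).add
    (continuous_const.mul ((continuous_rowNormSum q).comp
      (blockV n p J (√ν)).continuous_of_finiteDimensional))

variable {α μ ν}

theorem theta2_packThree (h1 : 0 ≤ M.lam1) (hα : 0 < α) (hμ : 0 < μ) (hν : 0 < ν)
    (A : Matrix (Fin n) (Fin J) ℝ) (U V : Matrix (Fin p) (Fin J) ℝ) :
    theta2 M q α μ ν (packThree n p J (√α) (√μ) (√ν) (A, U, V))
      = M.loss A + M.lam1 * l1Norm U + M.lam2 * rowNormSum q V := by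
  have hV : blockV n p J (√ν) (packThree n p J (√α) (√μ) (√ν) (A, U, V)) = V := by
    ext i j
    exact mul_div_cancel_left₀ _ (Real.sqrt_pos.2 hν).ne'
  rw [theta2, hV, ← theta1_packTwo M h1 hα hμ]
  rfl

theorem F2_eq (h1 : 0 ≤ M.lam1) (h3 : 0 ≤ M.lam3) (hα : 0 < α) (hμ : 0 < μ) (hν : 0 < ν)
    (W : Matrix (Fin p) (Fin J) ℝ) (b : Fin J → ℝ) (h : (W, b) ∈ D p J)
    (A : Matrix (Fin n) (Fin J) ℝ) (U V : Matrix (Fin p) (Fin J) ℝ) :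
    M.F2 q W b A U V = ‖ridgeMap p J 0 (√M.lam3) ⟨(W, b), h⟩‖ ^ 2 / 2
      + theta2 M q α μ ν (packThree n p J (√α) (√μ) (√ν) (A, U, V)) := by
  rw [theta2_packThree M q h1 hα hμ hν, norm_ridgeMap_sq, Real.sq_sqrt h3, Model.F2]
  ring

/-- Completing the square: the multipliers enter as `u = (Π / √α, Λ / √μ, Γ / √ν)`. -/
theorem L2_eq (h1 : 0 ≤ M.lam1) (h3 : 0 ≤ M.lam3) (hα : 0 < α) (hμ : 0 < μ) (hν : 0 < ν)
    (W : Matrix (Fin p) (Fin J) ℝ) (b : Fin J → ℝ) (h : (W, b) ∈ D p J)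
    (A : Matrix (Fin n) (Fin J) ℝ) (U V : Matrix (Fin p) (Fin J) ℝ)
    (Pm : Matrix (Fin n) (Fin J) ℝ) (Lm Gm : Matrix (Fin p) (Fin J) ℝ) :
    M.L2 q α μ ν W b A U V Pm Lm Gm = ‖ridgeMap p J 0 (√M.lam3) ⟨(W, b), h⟩‖ ^ 2 / 2
      + theta2 M q α μ ν (packThree n p J (√α) (√μ) (√ν) (A, U, V))
      + ‖constraint2 M α μ ν ⟨(W, b), h⟩ + offset2 n p J α μ ν
          - packThree n p J (√α) (√μ) (√ν) (A, U, V)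
          + packThree n p J (√α)⁻¹ (√μ)⁻¹ (√ν)⁻¹ (Pm, Lm, Gm)‖ ^ 2 / 2
      - ‖packThree n p J (√α)⁻¹ (√μ)⁻¹ (√ν)⁻¹ (Pm, Lm, Gm)‖ ^ 2 / 2 := by
  rw [constraint2_sub, norm_add_sq_real, inner_packThree, norm_packThree_sq,
    mul_inv_cancel₀ (Real.sqrt_pos.2 hα).ne', mul_inv_cancel₀ (Real.sqrt_pos.2 hμ).ne',
    mul_inv_cancel₀ (Real.sqrt_pos.2 hν).ne', Real.sq_sqrt hα.le, Real.sq_sqrt hμ.le,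
    Real.sq_sqrt hν.le, ← F2_eq M q h1 h3 hα hμ hν, Model.L2,
    frobInner_comm _ Pm, frobInner_comm _ Lm, frobInner_comm _ Gm]
  ring

theorem isADMMStep_of_step2 (h1 : 0 ≤ M.lam1) (h3 : 0 ≤ M.lam3) (hα : 0 < α) (hμ : 0 < μ)
    (hν : 0 < ν) {z z' : State2 n p J} (h : M.Step2 q α μ ν z z') :
    IsADMMStep (constraint2 M α μ ν) (ridgeMap p J 0 (√M.lam3)) (offset2 n p J α μ ν)
      (theta2 M q α μ ν) (packThree n p J (√α) (√μ) (√ν) (z.A, z.U, z.V))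
      (packThree n p J (√α)⁻¹ (√μ)⁻¹ (√ν)⁻¹ (z.Pm, z.Lm, z.Gm)) ⟨(z'.W, z'.b), h.mem_D⟩
      (packThree n p J (√α) (√μ) (√ν) (z'.A, z'.U, z'.V))
      (packThree n p J (√α)⁻¹ (√μ)⁻¹ (√ν)⁻¹ (z'.Pm, z'.Lm, z'.Gm)) where
  min_x := by
    rintro ⟨⟨W, b⟩, hWb⟩
    have := h.min_Wb W b hWb
    rw [L2_eq M q h1 h3 hα hμ hν _ _ h.mem_D, L2_eq M q h1 h3 hα hμ hν _ _ hWb] at this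
    linarith
  min_y := by
    intro v
    obtain ⟨A, U, V, rfl⟩ := packThree_surjective (Real.sqrt_pos.2 hα).ne'
      (Real.sqrt_pos.2 hμ).ne' (Real.sqrt_pos.2 hν).ne' v
    have := h.min_AUV A U V
    rw [L2_eq M q h1 h3 hα hμ hν _ _ h.mem_D, L2_eq M q h1 h3 hα hμ hν _ _ h.mem_D] at this
    linarith
  update := by
    rw [constraint2_sub, h.update_Pm, h.update_Lm, h.update_Gm]
    ext (i | i | i)
    · simp [packThree, mul_add, ← mul_assoc, inv_sqrt_mul_self]
    · simp [packThree, mul_add, ← mul_assoc, inv_sqrt_mul_self]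
    · simp [packThree, mul_add, ← mul_assoc, inv_sqrt_mul_self]

theorem exists_min2 [Fact (1 ≤ q)] (h1 : 0 ≤ M.lam1) (h2 : 0 ≤ M.lam2) (h3 : 0 ≤ M.lam3)
    (hα : 0 < α) (hμ : 0 < μ) (hν : 0 < ν) :
    ∃ x₀ : subspaceD p J, ∀ x : subspaceD p J,
      ‖ridgeMap p J 0 (√M.lam3) x₀‖ ^ 2 / 2
          + theta2 M q α μ ν (constraint2 M α μ ν x₀ + offset2 n p J α μ ν)
        ≤ ‖ridgeMap p J 0 (√M.lam3) x‖ ^ 2 / 2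
          + theta2 M q α μ ν (constraint2 M α μ ν x + offset2 n p J α μ ν) := by
  obtain ⟨x₀, hx₀⟩ := M.exists_min h3 (fun W => M.lam1 * l1Norm W + M.lam2 * rowNormSum q W)
    ((continuous_const.mul continuous_l1Norm).add (continuous_const.mul (continuous_rowNormSum q)))
    (fun W => by
      have := l1Norm_nonneg W
      have := rowNormSum_nonneg q W
      positivity)
    (t := M.lam1 + M.lam2) (a := 1 + J) (b := 0) (by positivity) (by positivity)
    (fun W => by
      have e1 := mul_le_mul_of_nonneg_left (norm_le_l1Norm W) h1
      have e2 := mul_le_mul_of_nonneg_left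
        ((norm_le_l1Norm W).trans (l1Norm_le_rowNormSum q W)) h2
      have e3 : 0 ≤ J * (M.lam1 * l1Norm W) := by have := l1Norm_nonneg W; positivity
      have e4 : 0 ≤ M.lam2 * rowNormSum q W := by have := rowNormSum_nonneg q W; positivity
      linarith)
    (fun h W => by
      have e1 : M.lam1 = 0 := by linarith
      have e2 : M.lam2 = 0 := by linarith
      simp [e1, e2])
  refine ⟨x₀, fun x => ?_⟩
  have := hx₀ x
  simp only [constraint2_add, theta2_packThree M q h1 hα hμ hν, norm_ridgeMap_sq, Real.sq_sqrt h3]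
  linarith

theorem rowNorm_convergence [Fact (1 ≤ q)] (h1 : 0 ≤ M.lam1) (h2 : 0 ≤ M.lam2) (h3 : 0 ≤ M.lam3)
    (hα : 0 < α) (hμ : 0 < μ) (hν : 0 < ν) :
    ∃ F2star : ℝ, IsLeast (M.values2 q) F2star ∧
      ∀ z : ℕ → State2 n p J, (∀ k, M.Step2 q α μ ν (z k) (z (k + 1))) →
        Tendsto (fun k => M.F2 q (z k).W (z k).b (z k).A (z k).U (z k).V) atTop (𝓝 F2star) ∧
        Tendsto (fun k => ‖M.res (z k).W (z k).b (z k).A‖) atTop (𝓝 0) ∧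
        Tendsto (fun k => ‖(z k).W - (z k).U‖) atTop (𝓝 0) ∧
        Tendsto (fun k => ‖(z k).W - (z k).V‖) atTop (𝓝 0) := by
  obtain ⟨xs, hxs⟩ := exists_min2 M q h1 h2 h3 hα hμ hν
  obtain ⟨us, hs⟩ := exists_isKKT (convexOn_theta2 M q α μ ν h2) (continuous_theta2 M q α μ ν) hxs
  have hval : ∀ x : subspaceD p J, ‖ridgeMap p J 0 (√M.lam3) x‖ ^ 2 / 2
      + theta2 M q α μ ν (constraint2 M α μ ν x + offset2 n p J α μ ν)
      = M.F2 q x.1.1 x.1.2 (M.decision x.1 + Matrix.of fun _ _ => 1) x.1.1 x.1.1 := fun x => by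
    rw [constraint2_add, F2_eq M q h1 h3 hα hμ hν _ _ x.2]
  refine ⟨_, ⟨⟨xs.1.1, xs.1.2, _, _, _, xs.2, rfl, rfl, rfl, hval xs⟩, ?_⟩, fun z hz => ?_⟩
  · rintro _ ⟨W, b, A, U, V, hWb, rfl, rfl, rfl, rfl⟩
    have := hxs ⟨(_, b), hWb⟩
    rw [hval ⟨(_, b), hWb⟩] at this
    exact this
  · obtain ⟨hres, hobj⟩ := tendsto_of_isADMMStep (convexOn_theta2 M q α μ ν h2)
      (fun k => isADMMStep_of_step2 M q h1 h3 hα hμ hν (hz k)) hs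
    simp only [constraint2_sub] at hres
    have hsq : ∀ k, ‖packThree n p J (√α) (√μ) (√ν)
        (M.res (z (k + 1)).W (z (k + 1)).b (z (k + 1)).A,
          (z (k + 1)).W - (z (k + 1)).U, (z (k + 1)).W - (z (k + 1)).V)‖ ^ 2
        = α * ‖M.res (z (k + 1)).W (z (k + 1)).b (z (k + 1)).A‖ ^ 2
          + (μ * ‖(z (k + 1)).W - (z (k + 1)).U‖ ^ 2
            + ν * ‖(z (k + 1)).W - (z (k + 1)).V‖ ^ 2) := fun k => by
      rw [norm_packThree_sq, Real.sq_sqrt hα.le, Real.sq_sqrt hμ.le, Real.sq_sqrt hν.le]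
    have p1 : ∀ k, 0 ≤ α * ‖M.res (z (k + 1)).W (z (k + 1)).b (z (k + 1)).A‖ ^ 2 :=
      fun k => by positivity
    have p2 : ∀ k, 0 ≤ μ * ‖(z (k + 1)).W - (z (k + 1)).U‖ ^ 2 := fun k => by positivity
    have p3 : ∀ k, 0 ≤ ν * ‖(z (k + 1)).W - (z (k + 1)).V‖ ^ 2 := fun k => by positivity
    refine ⟨?_, ?_, ?_, ?_⟩
    · refine (tendsto_add_atTop_iff_nat 1).1 (hobj.congr fun k => ?_)
      rw [F2_eq M q h1 h3 hα hμ hν _ _ (hz k).mem_D]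
    · refine (tendsto_add_atTop_iff_nat 1).1 (tendsto_zero_of_sq_le hα (fun k => norm_nonneg _)
        (fun k => norm_nonneg _) (fun k => ?_) hres)
      rw [hsq]
      linarith [p1 k, p2 k, p3 k]
    · refine (tendsto_add_atTop_iff_nat 1).1 (tendsto_zero_of_sq_le hμ (fun k => norm_nonneg _)
        (fun k => norm_nonneg _) (fun k => ?_) hres)
      rw [hsq]
      linarith [p1 k, p2 k, p3 k]
    · refine (tendsto_add_atTop_iff_nat 1).1 (tendsto_zero_of_sq_le hν (fun k => norm_nonneg _)
        (fun k => norm_nonneg _) (fun k => ?_) hres)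
      rw [hsq]
      linarith [p1 k, p2 k, p3 k]

end RowNorm

end MSVM

theorem theorem1 {n p J : ℕ} (hn : 0 < n) (M : MSVM.Model n p J)
    (h1 : 0 ≤ M.lam1) (h2 : 0 ≤ M.lam2) (h3 : 0 ≤ M.lam3)
    (α μ ν : ℝ) (hα : 0 < α) (hμ : 0 < μ) (hν : 0 < ν) :
    (∃ F1star : ℝ, IsLeast M.values1 F1star ∧
      ∀ z : ℕ → MSVM.State1 n p J, (∀ k, M.Step1 α μ (z k) (z (k + 1))) →
        Tendsto (fun k => M.F1 (z k).W (z k).b (z k).A (z k).U) atTop (𝓝 F1star) ∧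
        Tendsto (fun k => ‖M.res (z k).W (z k).b (z k).A‖) atTop (𝓝 0) ∧
        Tendsto (fun k => ‖(z k).W - (z k).U‖) atTop (𝓝 0) ∧
        (0 < M.lam2 → 0 < M.lam3 → MSVM.ConvergesLinearly z)) ∧
    (∀ q : ℝ≥0∞, q = 2 ∨ q = ∞ →
      ∃ F2star : ℝ, IsLeast (M.values2 q) F2star ∧
      ∀ z : ℕ → MSVM.State2 n p J, (∀ k, M.Step2 q α μ ν (z k) (z (k + 1))) →
        Tendsto (fun k => M.F2 q (z k).W (z k).b (z k).A (z k).U (z k).V) atTop (𝓝 F2star) ∧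
        Tendsto (fun k => ‖M.res (z k).W (z k).b (z k).A‖) atTop (𝓝 0) ∧
        Tendsto (fun k => ‖(z k).W - (z k).U‖) atTop (𝓝 0) ∧
        Tendsto (fun k => ‖(z k).W - (z k).V‖) atTop (𝓝 0)) := by
  refine ⟨MSVM.elasticNet_convergence M hn h1 h2 h3 hα hμ, ?_⟩
  rintro q (rfl | rfl)
  · exact MSVM.rowNorm_convergence M 2 h1 h2 h3 hα hμ hν
  · exact MSVM.rowNorm_convergence M ∞ h1 h2 h3 hα hμ hν
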